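/- Let $n=2^J$ with $J\ge 0$, and partition $\{1,\dots,n\}$ into the dyadic levels $\Omega_0=\{1\}$ and $\Omega_j=\{2^{j-1}+1,\dots,2^j\}$ for $1\le j\le J$; let $j(k)$ denote the level containing $k$. Let $A_0=\mathcal F\phi^*\in\mathbb C^{n\times n}$ be the unitary 1D Fourier–Haar matrix: $\mathcal F$ is the unitary discrete Fourier transform with rows ordered by increasing absolute frequency ($0,1,-1,2,-2,\dots,n/2$), and the columns of $\phi^*$ are the orthonormal discrete Haar basis vectors ordered from coarse to fine (first the constant vector, then, for $j=1,\dots,J$, the $2^{j-1}$ wavelets supported on the dyadic blocks of length $n/2^{j-1}$, indexed by $\Omega_j$). Write $a_k^*$ for the rows of $A_0$. Given a probability distribution $\pi$ on $\{1,\dots,n\}$ and i.i.d. indices $K_1,\dots,K_m$ with $\mathbb P(K_\ell=k)=\pi_k$, let $$A=\frac1{\sqrt m}\Big(\frac{1}{\sqrt{\pi_{K_\ell}}}\,a_{K_\ell}^*\Big)_{1\le \ell\le m}.$$ There is a universal constant $C>0$ such that the following holds for every $J$ and every $S\subset\{1,\dots,n\}$ of cardinality $s\ge 2$, with $s_j=|S\cap\Omega_j|$.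 (i) Let $\pi_k=\tilde\pi_{j(k)}$ be a probability distribution that is constant on levels, with $\tilde\pi_j>0$ for all $j$. Let $x\in\mathbb C^n$ be supported on $S$ and let $\varepsilon\in(0,1)$. If $$m\ \ge\ C\,\max_{0\le j\le J}\frac{1}{\tilde\pi_j}2^{-j}\sum_{p=0}^J2^{-|j-p|/2}s_p\cdot\ln(s)\,\ln\Big(\frac n\varepsilon\Big),$$ then, with probability at least $1-\varepsilon$, $x$ is the unique solution of $\min\{\|z\|_1: z\in\mathbb C^n,\ Az=Ax\}$. (ii) Among all such level-constant distributions, the unique one minimizing the lower bound on $m$ in (i) is $$\tilde\pi_j=\frac{2^{-j}\sum_{p=0}^J2^{-|j-p|/2}s_p}{\sum_{\ell=1}^n2^{-j(\ell)}\sum_{p=0}^J2^{-|j(\ell)-p|/2}s_p}.$$ (iii) For the distribution in (ii), every $x\in\mathbb C^n$ supported on $S$ and every $\varepsilon\in(0,1)$, the condition $$m\ \ge\ C\sum_{j=0}^J\Big(s_j+\sum_{p\ne j}2^{-|j-p|/2}s_p\Big)\ln(s)\,\ln\Big(\frac n\varepsilon\Big)$$ suffices for $x$ to be, with probability at least $1-\varepsilon$,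 the unique solution of $\min\{\|z\|_1: z\in\mathbb C^n,\ Az=Ax\}$. -/

import Mathlib

open MeasureTheory ProbabilityTheory

namespace FourierHaar

/-! Throughout the signal length is `n = 2 ^ J`, and the indices `1, …, n` of the text are shifted to
`0, …, n - 1`, that is, to `Fin (2 ^ J)`. -/

theorem level_lt (J : ℕ) (u : Fin (2 ^ J)) :
    (if (u : ℕ) = 0 then 0 else Nat.log 2 (u : ℕ) + 1) < J + 1 := by
  split_ifs with h
  · omega
  · exact Nat.succ_lt_succ (Nat.log_lt_of_lt_pow h u.isLt)

/-- The dyadic level of an index (0-based): level `0` is `{0}` and, for `j ≥ 1`, level `j` is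
`{2 ^ (j - 1), …, 2 ^ j - 1}`. -/
def level (J : ℕ) (u : Fin (2 ^ J)) : Fin (J + 1) :=
  ⟨if (u : ℕ) = 0 then 0 else Nat.log 2 (u : ℕ) + 1, level_lt J u⟩

/-- The frequency of the `k`-th Fourier row (0-based): `0, 1, -1, 2, -2, …, n / 2`, so that
`|frequency k|` is nondecreasing. -/
def frequency (k : ℕ) : ℤ := if Even k then -((k / 2 : ℕ) : ℤ) else (((k + 1) / 2 : ℕ) : ℤ)

/-- The unitary discrete Fourier transform on `ℂⁿ`, with rows ordered by frequency. -/
noncomputable def fourierMatrix (J : ℕ) : Matrix (Fin (2 ^ J)) (Fin (2 ^ J)) ℂ := fun k t =>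
  ((1 / Real.sqrt (2 ^ J) : ℝ) : ℂ) *
    Complex.exp (-2 * Real.pi * Complex.I * (frequency k : ℂ) * ((t : ℕ) : ℂ) / 2 ^ J)

/-- The inverse Haar transform: column `u` is the `u`-th vector of the orthonormal discrete Haar
basis. Column `0` is the constant vector; column `2 ^ i + q` with `0 ≤ q < 2 ^ i` is the Haar wavelet
with value `√(2 ^ i / n)` on the dyadic block `[2 q h, (2 q + 1) h)` and `-√(2 ^ i / n)` on
`[(2 q + 1) h, (2 q + 2) h)`, where `h = n / 2 ^ (i + 1)`. -/
noncomputable def inverseHaarMatrix (J : ℕ) : Matrix (Fin (2 ^ J)) (Fin (2 ^ J)) ℂ := fun t u =>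
  if (u : ℕ) = 0 then ((1 / Real.sqrt (2 ^ J) : ℝ) : ℂ)
  else
    let i := Nat.log 2 (u : ℕ)
    let q := (u : ℕ) - 2 ^ i
    let h := 2 ^ (J - (i + 1))
    if (t : ℕ) / h = 2 * q then ((Real.sqrt (2 ^ i / 2 ^ J) : ℝ) : ℂ)
    else if (t : ℕ) / h = 2 * q + 1 then -((Real.sqrt (2 ^ i / 2 ^ J) : ℝ) : ℂ)
    else 0

/-- The one-dimensional Fourier-Haar matrix. -/
noncomputable def fourierHaarMatrix (J : ℕ) : Matrix (Fin (2 ^ J)) (Fin (2 ^ J)) ℂ :=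
  fourierMatrix J * inverseHaarMatrix J

/-- The sensing matrix whose `ℓ`-th row is `1 / √m * 1 / √(π (K ℓ))` times the `K ℓ`-th row
of `A₀`. -/
noncomputable def sensingMatrix {ι : Type*} {m : ℕ} (A₀ : Matrix ι ι ℂ) (prob : ι → ℝ)
    (K : Fin m → ι) : Matrix (Fin m) ι ℂ := fun l i =>
  ((1 / Real.sqrt m * (1 / Real.sqrt (prob (K l))) : ℝ) : ℂ) * A₀ (K l) i

/-- `z` solves the problem of minimizing `‖z‖₁` subject to `A z = y`. -/
def IsL1Minimizer {ι : Type*} [Fintype ι] {m : ℕ} (A : Matrix (Fin m) ι ℂ) (y : Fin m → ℂ)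
    (z : ι → ℂ) : Prop :=
  A.mulVec z = y ∧ ∀ w : ι → ℂ, A.mulVec w = y → ∑ i, ‖z i‖ ≤ ∑ i, ‖w i‖

/-- `x` is the unique solution of the problem of minimizing `‖z‖₁` subject to `A z = A x`. -/
def IsUniquelyRecovered {ι : Type*} [Fintype ι] {m : ℕ} (A : Matrix (Fin m) ι ℂ) (x : ι → ℂ) :
    Prop :=
  ∀ z : ι → ℂ, IsL1Minimizer A (A.mulVec x) z ↔ z = x

/-- `K 0, …, K (m - 1)` are independent draws, each with `P (K ℓ = k) = prob k`. -/
def IsIIDSample {Ω ι : Type*} [MeasurableSpace Ω] [MeasurableSpace ι] {m : ℕ} (μ : Measure Ω)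
    (prob : ι → ℝ) (K : Fin m → Ω → ι) : Prop :=
  (∀ l, Measurable (K l)) ∧ iIndepFun K μ ∧
    ∀ l k, μ (K l ⁻¹' {k}) = ENNReal.ofReal (prob k)

/-- The level values `w j` define, by `π k = w (level k)`, a probability distribution on the row
indices that charges every row. -/
def IsLevelDistribution (J : ℕ) (w : Fin (J + 1) → ℝ) : Prop :=
  (∀ j, 0 < w j) ∧ ∑ k : Fin (2 ^ J), w (level J k) = 1

/-- The number of indices of `S` in level `j`. -/
def levelSparsity {J : ℕ} (S : Finset (Fin (2 ^ J))) (j : Fin (J + 1)) : ℕ :=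
  (S.filter fun u => level J u = j).card

/-- The factor `2 ^ (-|j - p| / 2)`. -/
noncomputable def decay {J : ℕ} (j p : Fin (J + 1)) : ℝ :=
  (2 : ℝ) ^ (-|((j : ℕ) : ℝ) - ((p : ℕ) : ℝ)| / 2)

/-- `max_j (1 / w j) * 2 ^ (-j) * ∑_p 2 ^ (-|j - p| / 2) * s_p`. -/
noncomputable def samplingBound {J : ℕ} (S : Finset (Fin (2 ^ J))) (w : Fin (J + 1) → ℝ) : ℝ :=
  ⨆ j : Fin (J + 1),
    1 / w j * (1 / 2 ^ (j : ℕ)) * ∑ p : Fin (J + 1), decay j p * (levelSparsity S p : ℝ)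

/-- The level values of the optimal distribution. -/
noncomputable def optimalWeight {J : ℕ} (S : Finset (Fin (2 ^ J))) (j : Fin (J + 1)) : ℝ :=
  (1 / 2 ^ (j : ℕ) * ∑ p : Fin (J + 1), decay j p * (levelSparsity S p : ℝ)) /
    ∑ k : Fin (2 ^ J), (1 / 2 ^ (level J k : ℕ) *
      ∑ p : Fin (J + 1), decay (level J k) p * (levelSparsity S p : ℝ))

end FourierHaar

/-! Recovery follows from dual certificates built by golfing. Split the draws into `L ≈ log₂ s`
batches. In each batch the empirical version of `A₀ᴴ A₀` applied to a fixed vector `w` supported on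
`S` with `|w_i| ≤ 1` is, coordinatewise, an average of independent bounded terms with mean `w`. A
scalar Bernstein bound and a union over coordinates put it within `1 / 4` of `w`. The residual on
`S`, rescaled by `4`, is again such a vector and is independent of the later batches, so the error
on `S` shrinks by `4` per batch while the values off `S` stay at most `1 / 3`.

The usual argument also needs the sampled matrix to be well conditioned on `S`, hence a matrix
concentration inequality. This is avoided by golfing towards every coordinate vector `e_u`, `u ∈ S`,
as well as towards the sign of `x`. For `h` in the kernel of the sampled rows, the `e_u`
certificates bound each `|h_u|`, so `h` on `S` is controlled by `h` off `S`. The sign certificate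
then makes `x` the strict minimizer (`norm_sum_lt_of_certificates`). Only `s + 1` certificates are
needed, so the union bound costs a polynomial in `n` (`massOf_no_certificate_le`,
`IsIncoherent.le_measureReal_isUniquelyRecovered`).

What remains is the incoherence of the Fourier–Haar matrix. On the columns of one wavelet level it
is a scalar symbol depending on the frequency times a smaller Fourier matrix. The symbol is
estimated from the geometric sum and elementary sine bounds (`haarSymbol_level_bound`), and Parseval
then gives the block for levels `j`, `p` an operator norm of order `2 ^ (-|j - p| / 2)`
(`sum_level_norm_sq_le`). Cauchy–Schwarz across blocks gives `isIncoherent_fourierHaarMatrix`, with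
constant a multiple of `samplingBound`.

Optimality is a duality remark. With `T_j = ∑_p 2 ^ (-|j - p| / 2) s_p` and `B` the maximum of `2 ^
(-j) T_j / w_j`, one has `2 ^ (-j) T_j ≤ B w_j`. Summing over rows bounds `B` below by the
normalizing constant, with equality only if every term is an equality. -/

namespace FourierHaar

/-! ### Concentration over finite product weights, and the golfing scheme. -/

section Golfing

open Classical in
/-- The total weight of the points of a finite type that satisfy a predicate. -/
noncomputable def massOf {κ : Type*} [Fintype κ] (q : κ → ℝ) (P : κ → Prop) : ℝ :=
  ∑ c, if P c then q c else 0

theorem massOf_le_sum {κ τ : Type*} [Fintype κ] {q : κ → ℝ} (hq : ∀ c, 0 ≤ q c) {P : κ → Prop}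
    (T : Finset τ) (Q : τ → κ → Prop) (h : ∀ c, P c → ∃ i ∈ T, Q i c) :
    massOf q P ≤ ∑ i ∈ T, massOf q (Q i) := by
  classical
  unfold massOf
  rw [Finset.sum_comm]
  refine Finset.sum_le_sum fun c _ => ?_
  have h0 : ∀ i ∈ T, 0 ≤ if Q i c then q c else 0 := fun i _ => by
    split_ifs
    exacts [hq c, le_rfl]
  by_cases hP : P c
  · obtain ⟨i, hi, hQ⟩ := h c hP
    refine le_trans ?_ (Finset.single_le_sum h0 hi)
    simp [hP, hQ]
  · rw [if_neg hP]
    exact Finset.sum_nonneg h0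

variable {ι : Type*} [Fintype ι]

/-- A Bernstein-type upper tail bound for an average of independent bounded variables. -/
theorem massOf_upper_tail_le {π : ι → ℝ} (hπ : ∀ k, 0 ≤ π k) (hsum : ∑ k, π k = 1) {Γ : ℝ}
    (hΓ : 1 ≤ Γ) {X : ι → ℝ} (hX : ∀ k, |X k| ≤ Γ) (hX2 : ∑ k, π k * X k ^ 2 ≤ Γ) (m : ℕ) :
    massOf (fun c : Fin m → ι => ∏ l, π (c l))
      (fun c => m * (∑ k, π k * X k + 1 / 8) ≤ ∑ l, X (c l)) ≤ Real.exp (-(m / (256 * Γ))) := by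
  classical
  have hΓ0 : 0 < Γ := by linarith
  -- This choice minimizes `lam ^ 2 * Γ - lam / 8`, the exponent per draw, whose value is then `-1 /
  -- (256 * Γ)`.
  set lam : ℝ := 1 / (16 * Γ) with hlam
  have hlam0 : 0 < lam := by positivity
  set M : ℝ := ∑ k, π k * X k with hM
  have hmgf : ∑ k, π k * Real.exp (lam * X k) ≤ Real.exp (lam * M + lam ^ 2 * Γ) := by
    have h1 : ∀ k, Real.exp (lam * X k) ≤ 1 + lam * X k + lam ^ 2 * X k ^ 2 := by
      intro k
      have hb : |lam * X k| ≤ 1 := by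
        rw [abs_mul, abs_of_pos hlam0]
        calc lam * |X k| ≤ lam * Γ := by gcongr; exact hX k
          _ = 1 / 16 := by rw [hlam]; field_simp
          _ ≤ 1 := by norm_num
      have := (abs_le.1 (Real.abs_exp_sub_one_sub_id_le hb)).2
      nlinarith
    calc ∑ k, π k * Real.exp (lam * X k)
        ≤ ∑ k, π k * (1 + lam * X k + lam ^ 2 * X k ^ 2) :=
          Finset.sum_le_sum fun k _ => mul_le_mul_of_nonneg_left (h1 k) (hπ k)
      _ = 1 + lam * M + lam ^ 2 * ∑ k, π k * X k ^ 2 := by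
          rw [hM, ← hsum, Finset.mul_sum, Finset.mul_sum, ← Finset.sum_add_distrib,
            ← Finset.sum_add_distrib]
          exact Finset.sum_congr rfl fun k _ => by rw [hsum]; ring
      _ ≤ 1 + lam * M + lam ^ 2 * Γ := by gcongr
      _ ≤ Real.exp (lam * M + lam ^ 2 * Γ) := by
          have := Real.add_one_le_exp (lam * M + lam ^ 2 * Γ)
          linarith
  calc massOf (fun c : Fin m → ι => ∏ l, π (c l)) (fun c => m * (M + 1 / 8) ≤ ∑ l, X (c l))
      ≤ ∑ c : Fin m → ι, Real.exp (-(lam * (m * (M + 1 / 8)))) *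
          ∏ l, (π (c l) * Real.exp (lam * X (c l))) := by
        unfold massOf
        refine Finset.sum_le_sum fun c _ => ?_
        have hp : 0 ≤ ∏ l, π (c l) := Finset.prod_nonneg fun l _ => hπ _
        rw [Finset.prod_mul_distrib, ← Real.exp_sum, ← Finset.mul_sum]
        have he : Real.exp (-(lam * (m * (M + 1 / 8)))) *
            ((∏ l, π (c l)) * Real.exp (lam * ∑ l, X (c l))) =
            (∏ l, π (c l)) * Real.exp (lam * (∑ l, X (c l) - m * (M + 1 / 8))) := by
          rw [mul_left_comm, ← Real.exp_add]
          ring_nf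
        rw [he]
        split_ifs with h
        · refine le_mul_of_one_le_right hp (Real.one_le_exp ?_)
          exact mul_nonneg hlam0.le (sub_nonneg.2 h)
        · positivity
    _ = Real.exp (-(lam * (m * (M + 1 / 8)))) * (∑ k, π k * Real.exp (lam * X k)) ^ m := by
        rw [← Finset.mul_sum, Fintype.sum_pow]
    _ ≤ Real.exp (-(lam * (m * (M + 1 / 8)))) * Real.exp (lam * M + lam ^ 2 * Γ) ^ m := by
        gcongr
        exact Finset.sum_nonneg fun k _ => mul_nonneg (hπ k) (Real.exp_nonneg _)
    _ = Real.exp (-(m / (256 * Γ))) := by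
        rw [← Real.exp_nat_mul, ← Real.exp_add]
        congr 1
        rw [hlam]
        field_simp
        ring

/-- The real bound is applied to `±re` and `±im`: if none of the four one-sided deviations reaches
`1 / 8`, then `|re| + |im| ≤ 1 / 4`. -/
theorem massOf_complex_tail_le {π : ι → ℝ} (hπ : ∀ k, 0 ≤ π k) (hsum : ∑ k, π k = 1) {Γ : ℝ}
    (hΓ : 1 ≤ Γ) {X : ι → ℂ} (hX : ∀ k, ‖X k‖ ≤ Γ) (hX2 : ∑ k, π k * ‖X k‖ ^ 2 ≤ Γ) {m : ℕ}
    (hm : 0 < m) :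
    massOf (fun c : Fin m → ι => ∏ l, π (c l))
      (fun c => 1 / 4 < ‖(1 / (m : ℂ)) * ∑ l, X (c l) - ∑ k, (π k : ℂ) * X k‖) ≤
      4 * Real.exp (-(m / (256 * Γ))) := by
  classical
  let Y : Fin 4 → ι → ℝ := ![fun k => (X k).re, fun k => -(X k).re, fun k => (X k).im,
    fun k => -(X k).im]
  have hYb : ∀ i k, |Y i k| ≤ ‖X k‖ := by
    intro i k
    fin_cases i <;> simp [Y, Complex.abs_re_le_norm, Complex.abs_im_le_norm]
  have hm' : (0 : ℝ) < m := by exact_mod_cast hm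
  have key := massOf_le_sum (q := fun c : Fin m → ι => ∏ l, π (c l))
    (P := fun c => 1 / 4 < ‖(1 / (m : ℂ)) * ∑ l, X (c l) - ∑ k, (π k : ℂ) * X k‖)
    (fun c => Finset.prod_nonneg fun l _ => hπ _) Finset.univ
    (fun i c => m * (∑ k, π k * Y i k + 1 / 8) ≤ ∑ l, Y i (c l)) ?_
  · refine key.trans ?_
    calc _ ≤ ∑ _i : Fin 4, Real.exp (-(m / (256 * Γ))) := by
          refine Finset.sum_le_sum fun i _ => massOf_upper_tail_le hπ hsum hΓ
            (fun k => (hYb i k).trans (hX k)) (le_trans ?_ hX2) m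
          refine Finset.sum_le_sum fun k _ => mul_le_mul_of_nonneg_left ?_ (hπ k)
          rw [← sq_abs]
          gcongr
          exact hYb i k
      _ = _ := by simp
  · intro c hc
    by_contra! hcon
    have h0 := hcon 0 (Finset.mem_univ _)
    have h1 := hcon 1 (Finset.mem_univ _)
    have h2 := hcon 2 (Finset.mem_univ _)
    have h3 := hcon 3 (Finset.mem_univ _)
    simp only [Y, Matrix.cons_val, mul_neg, Finset.sum_neg_distrib] at h0 h1 h2 h3
    have hre : ((1 / (m : ℂ)) * ∑ l, X (c l) - ∑ k, (π k : ℂ) * X k).re =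
        (1 / m) * ∑ l, (X (c l)).re - ∑ k, π k * (X k).re := by
      have : (1 / (m : ℂ)) = ((1 / m : ℝ) : ℂ) := by push_cast; rfl
      rw [this]
      simp
    have him : ((1 / (m : ℂ)) * ∑ l, X (c l) - ∑ k, (π k : ℂ) * X k).im =
        (1 / m) * ∑ l, (X (c l)).im - ∑ k, π k * (X k).im := by
      have : (1 / (m : ℂ)) = ((1 / m : ℝ) : ℂ) := by push_cast; rfl
      rw [this]
      simp
    have habs : ∀ s M : ℝ, s < m * (M + 1 / 8) → -s < m * (-M + 1 / 8) →
        |(1 / m) * s - M| ≤ 1 / 8 := by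
      intro s M ha hb
      have e : s = m * ((1 / m) * s) := by field_simp
      rw [abs_le]
      constructor
      · by_contra! hlt
        nlinarith
      · by_contra! hlt
        nlinarith
    have := Complex.norm_le_abs_re_add_abs_im
      ((1 / (m : ℂ)) * ∑ l, X (c l) - ∑ k, (π k : ℂ) * X k)
    rw [hre, him] at this
    have ha := habs _ _ h0 h1
    have hb := habs _ _ h2 h3
    linarith

/-- The empirical version of `A₀ᴴ A₀` along the sampled rows `c`, applied to `w`. -/
noncomputable def empirical (A₀ : Matrix ι ι ℂ) (π : ι → ℝ) {m : ℕ} (c : Fin m → ι)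
    (w : ι → ℂ) (i : ι) : ℂ :=
  (1 / (m : ℂ)) * ∑ l, star (A₀ (c l) i) * A₀.mulVec w (c l) / (π (c l) : ℂ)

/-- The vectors supported on `S` with entries of modulus at most one. -/
def IsUnitOn (S : Finset ι) (w : ι → ℂ) : Prop := (∀ i, ‖w i‖ ≤ 1) ∧ ∀ i, i ∉ S → w i = 0

/-- The two incoherence conditions on an isometry `A₀`, sampled with probabilities `π`, relative to
a support `S`. -/
structure IsIncoherent (A₀ : Matrix ι ι ℂ) (π : ι → ℝ) (S : Finset ι) (Γ : ℝ) : Prop where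
  pos : ∀ k, 0 < π k
  sum_eq : ∑ k, π k = 1
  one_le : 1 ≤ Γ
  isometry : ∀ w i, ∑ k, star (A₀ k i) * A₀.mulVec w k = w i
  bound : ∀ v, IsUnitOn S v → ∀ k i, ‖A₀ k i‖ * ‖A₀.mulVec v k‖ / π k ≤ Γ
  variance : ∀ v, IsUnitOn S v → ∀ i, ∑ k, ‖A₀ k i‖ ^ 2 * ‖A₀.mulVec v k‖ ^ 2 / π k ≤ Γ

/-- Dividing by `π` makes each sampled term unbiased, its mean being `w i` by the isometry identity.
`bound` and `variance` are exactly the Bernstein hypotheses for it. -/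
theorem IsIncoherent.massOf_empirical_le {A₀ : Matrix ι ι ℂ} {π : ι → ℝ} {S : Finset ι} {Γ : ℝ}
    (H : IsIncoherent A₀ π S Γ) {w : ι → ℂ} (hw : IsUnitOn S w) {m : ℕ} (hm : 0 < m) :
    massOf (fun c : Fin m → ι => ∏ l, π (c l))
      (fun c => ∃ i, 1 / 4 < ‖empirical A₀ π c w i - w i‖) ≤
      Fintype.card ι * (4 * Real.exp (-(m / (256 * Γ)))) := by
  classical
  have hπ : ∀ k, 0 ≤ π k := fun k => (H.pos k).le
  refine (massOf_le_sum (fun c => Finset.prod_nonneg fun l _ => hπ _) Finset.univ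
    (fun i c => 1 / 4 < ‖empirical A₀ π c w i - w i‖) ?_).trans ?_
  · rintro c ⟨i, hi⟩
    exact ⟨i, Finset.mem_univ _, hi⟩
  · rw [← nsmul_eq_mul, ← Finset.card_univ, ← Finset.sum_const]
    refine Finset.sum_le_sum fun i _ => ?_
    have hne : ∀ k, (π k : ℂ) ≠ 0 := fun k => by exact_mod_cast (H.pos k).ne'
    have hn : ∀ k, ‖star (A₀ k i) * A₀.mulVec w k / (π k : ℂ)‖ =
        ‖A₀ k i‖ * ‖A₀.mulVec w k‖ / π k := fun k => by
      rw [norm_div, norm_mul, norm_star, Complex.norm_real, Real.norm_of_nonneg (hπ k)]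
    have hmean : ∑ k, (π k : ℂ) * (star (A₀ k i) * A₀.mulVec w k / (π k : ℂ)) = w i := by
      rw [← H.isometry w i]
      exact Finset.sum_congr rfl fun k _ => mul_div_cancel₀ _ (hne k)
    have := massOf_complex_tail_le hπ H.sum_eq H.one_le
      (X := fun k => star (A₀ k i) * A₀.mulVec w k / (π k : ℂ)) (m := m)
      (fun k => by rw [hn]; exact H.bound w hw k i) ?_ hm
    · rw [hmean] at this
      exact this
    · refine le_trans (le_of_eq (Finset.sum_congr rfl fun k _ => ?_)) (H.variance w hw i)
      rw [hn]
      have := (H.pos k).ne'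
      field_simp

/-- `ν` is orthogonal to every vector annihilated by the rows in `R`; on `S` it is `δ`-close to `w`
and off `S` it is at most `1 / 3`. -/
structure IsCertificate (A₀ : Matrix ι ι ℂ) (S : Finset ι) (R : Set ι) (w : ι → ℂ) (δ : ℝ)
    (ν : ι → ℂ) : Prop where
  orthogonal : ∀ h : ι → ℂ, (∀ k ∈ R, A₀.mulVec h k = 0) → ∑ i, star (ν i) * h i = 0
  near : ∀ i ∈ S, ‖ν i - w i‖ ≤ δ
  small : ∀ i ∉ S, ‖ν i‖ ≤ 1 / 3

theorem empirical_orthogonal (A₀ : Matrix ι ι ℂ) (π : ι → ℝ) {m : ℕ} (c : Fin m → ι)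
    (w h : ι → ℂ) (hh : ∀ l, A₀.mulVec h (c l) = 0) :
    ∑ i, star (empirical A₀ π c w i) * h i = 0 := by
  have : ∀ i, star (empirical A₀ π c w i) * h i =
      ∑ l, star (1 / (m : ℂ)) * (star (A₀.mulVec w (c l)) / star (π (c l) : ℂ)) *
        (A₀ (c l) i * h i) := by
    intro i
    simp only [empirical, star_mul', star_sum, star_div₀, star_star, Finset.mul_sum,
      Finset.sum_mul]
    exact Finset.sum_congr rfl fun l _ => by ring
  simp_rw [this]
  rw [Finset.sum_comm]
  refine Finset.sum_eq_zero fun l _ => ?_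
  rw [← Finset.mul_sum]
  have := hh l
  simp only [Matrix.mulVec, dotProduct] at this
  rw [this, mul_zero]

open Classical in
/-- One golfing step. -/
theorem exists_certificate_step {A₀ : Matrix ι ι ℂ} {π : ι → ℝ} {S : Finset ι} {w : ι → ℂ} {m : ℕ}
    {c : Fin m → ι} (hc : ∀ i, ‖empirical A₀ π c w i - w i‖ ≤ 1 / 4)
    (hw : IsUnitOn S w) :
    ∃ w', IsUnitOn S w' ∧ ∀ (R : Set ι) (δ : ℝ) (ν : ι → ℂ), IsCertificate A₀ S R w' δ ν →
      ∃ ν', IsCertificate A₀ S (Set.range c ∪ R) w (δ / 4) ν' := by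
  -- The new target is the residual on `S`, rescaled to modulus at most one. A certificate for it is
  -- scaled back by `1 / 4` and added to the present estimate.
  refine ⟨fun i => if i ∈ S then 4 * (w i - empirical A₀ π c w i) else 0, ⟨fun i => ?_, fun i hi =>
    if_neg hi⟩, fun R δ ν hν => ⟨fun i => empirical A₀ π c w i + 1 / 4 * ν i, fun h hh => ?_,
    fun i hi => ?_, fun i hi => ?_⟩⟩
  · dsimp only
    split_ifs
    · rw [norm_mul, norm_sub_rev]
      have := hc i
      norm_num
      linarith
    · simp
  · simp only [star_add, star_mul', add_mul, Finset.sum_add_distrib]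
    rw [empirical_orthogonal A₀ π c w h fun l => hh _ (Or.inl ⟨l, rfl⟩)]
    have := hν.orthogonal h fun k hk => hh k (Or.inr hk)
    simp_rw [mul_assoc]
    rw [← Finset.mul_sum, this]
    simp
  · have := hν.near i hi
    simp only [if_pos hi] at this
    rw [show empirical A₀ π c w i + 1 / 4 * ν i - w i =
      1 / 4 * (ν i - 4 * (w i - empirical A₀ π c w i)) by ring, norm_mul]
    norm_num
    linarith
  -- The bound `1 / 3` is the fixed point of `t ↦ 1 / 4 + t / 4`, so it survives any number of
  -- steps.
  · have h1 := hc i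
    have h2 := hν.small i hi
    rw [hw.2 i hi, sub_zero] at h1
    refine (norm_add_le _ _).trans ?_
    rw [norm_mul]
    norm_num
    linarith

/-- Induction by conditioning on the first batch. The next target depends only on that batch, so the
bound for a fixed target applies to the remaining ones. -/
theorem massOf_no_certificate_le {A₀ : Matrix ι ι ℂ} {π : ι → ℝ} {S : Finset ι}
    {Γ : ℝ} (H : IsIncoherent A₀ π S Γ) {m : ℕ} (hm : 0 < m) (L : ℕ) {w : ι → ℂ}
    (hw : IsUnitOn S w) :
    massOf (fun b : Fin L → Fin m → ι => ∏ i, ∏ l, π (b i l))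
      (fun b => ¬ ∃ ν, IsCertificate A₀ S {k | ∃ i l, b i l = k} w ((1 / 4) ^ L) ν) ≤
      L * (Fintype.card ι * (4 * Real.exp (-(m / (256 * Γ))))) := by
  classical
  have hπ : ∀ k, 0 ≤ π k := fun k => (H.pos k).le
  have hq : ∀ c : Fin m → ι, 0 ≤ ∏ l, π (c l) := fun c => Finset.prod_nonneg fun l _ => hπ _
  have hq1 : ∀ L : ℕ, ∑ b : Fin L → Fin m → ι, ∏ i, ∏ l, π (b i l) = 1 := fun L => by
    rw [← Fintype.sum_pow (fun c : Fin m → ι => ∏ l, π (c l)), ← Fintype.sum_pow, H.sum_eq]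
    simp
  set B : ℝ := Fintype.card ι * (4 * Real.exp (-(m / (256 * Γ)))) with hB
  have hB0 : 0 ≤ B := by positivity
  induction L generalizing w with
  | zero =>
    unfold massOf
    simp only [Nat.cast_zero, zero_mul]
    refine le_of_eq (Finset.sum_eq_zero fun b _ => if_neg ?_)
    rw [not_not]
    -- With no batches the zero vector is a certificate with error `(1 / 4) ^ 0 = 1`.
    exact ⟨0, fun h _ => by simp, fun i _ => by simpa using hw.1 i, fun i _ => by simp⟩
  | succ L ih =>
    unfold massOf
    rw [← (Fin.consEquiv fun _ => Fin m → ι).sum_comp, Fintype.sum_prod_type]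
    calc _ ≤ ∑ c : Fin m → ι, ((if ∃ i, 1 / 4 < ‖empirical A₀ π c w i - w i‖ then
            ∏ l, π (c l) else 0) + (∏ l, π (c l)) * (L * B)) := by
          refine Finset.sum_le_sum fun c _ => ?_
          simp only [Fin.consEquiv_apply, Fin.prod_univ_succ, Fin.cons_zero, Fin.cons_succ]
          by_cases hc : ∃ i, 1 / 4 < ‖empirical A₀ π c w i - w i‖
          · rw [if_pos hc]
            calc _ ≤ ∑ b : Fin L → Fin m → ι, (∏ l, π (c l)) * ∏ i, ∏ l, π (b i l) := by
                  refine Finset.sum_le_sum fun b _ => ?_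
                  split_ifs
                  · exact mul_nonneg (hq c) (Finset.prod_nonneg fun i _ => hq _)
                  · exact le_rfl
              _ = ∏ l, π (c l) := by rw [← Finset.mul_sum, hq1, mul_one]
              _ ≤ _ := le_add_of_nonneg_right (mul_nonneg (hq c) (by positivity))
          · rw [if_neg hc, zero_add]
            push Not at hc
            obtain ⟨w', hw', hstep⟩ := exists_certificate_step hc hw
            refine le_trans ?_ (mul_le_mul_of_nonneg_left (ih hw') (hq c))
            unfold massOf
            rw [Finset.mul_sum]
            refine Finset.sum_le_sum fun b _ => ?_
            rw [mul_ite, mul_zero]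
            by_cases hb : ∃ ν, IsCertificate A₀ S {k | ∃ i l, b i l = k} w' ((1 / 4) ^ L) ν
            · obtain ⟨ν, hν⟩ := hb
              obtain ⟨ν', hν'⟩ := hstep _ _ _ hν
              rw [if_neg, if_neg (not_not.2 ⟨ν, hν⟩)]
              rw [not_not]
              refine ⟨ν', fun h hh => hν'.orthogonal h ?_, fun i hi => ?_, hν'.small⟩
              · rintro k (⟨l, rfl⟩ | ⟨i, l, rfl⟩)
                · exact hh _ ⟨0, l, rfl⟩
                · exact hh _ ⟨i.succ, l, rfl⟩
              · exact (hν'.near i hi).trans (le_of_eq (by rw [pow_succ]; ring))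
            · rw [if_pos hb]
              split_ifs
              · exact mul_nonneg (hq c) (Finset.prod_nonneg fun i _ => hq _)
              · exact le_rfl
      _ = massOf (fun c : Fin m → ι => ∏ l, π (c l))
            (fun c => ∃ i, 1 / 4 < ‖empirical A₀ π c w i - w i‖) + L * B := by
          rw [Finset.sum_add_distrib, ← Finset.sum_mul, ← Fintype.sum_pow, H.sum_eq]
          simp [massOf]
      _ ≤ B + L * B := by
          gcongr
          exact H.massOf_empirical_le hw hm
      _ = _ := by push_cast; ring

end Golfing

/-! ### From certificates to unique `ℓ¹` recovery with high probability. -/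

section Recovery

variable {ι : Type*} [Fintype ι]

theorem IsCertificate.norm_sum_le [DecidableEq ι] {A₀ : Matrix ι ι ℂ} {S : Finset ι} {R : Set ι}
    {w : ι → ℂ} {δ : ℝ} {ν : ι → ℂ} (H : IsCertificate A₀ S R w δ ν) {h : ι → ℂ}
    (hh : ∀ k ∈ R, A₀.mulVec h k = 0) :
    ‖∑ i ∈ S, star (w i) * h i‖ ≤ δ * ∑ i ∈ S, ‖h i‖ + 1 / 3 * ∑ i ∈ Sᶜ, ‖h i‖ := by
  have h0 := H.orthogonal h hh
  rw [← Finset.sum_add_sum_compl S] at h0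
  have e : ∑ i ∈ S, star (w i) * h i =
      -(∑ i ∈ S, star (ν i - w i) * h i) - ∑ i ∈ Sᶜ, star (ν i) * h i := by
    rw [← eq_neg_iff_add_eq_zero] at h0
    simp only [star_sub, sub_mul, Finset.sum_sub_distrib]
    rw [h0]
    ring
  rw [e, Finset.mul_sum, Finset.mul_sum]
  refine (norm_sub_le _ _).trans (add_le_add ?_ ?_)
  · rw [norm_neg]
    refine norm_sum_le_of_le _ fun i hi => ?_
    rw [norm_mul, norm_star]
    gcongr
    exact H.near i hi
  · refine norm_sum_le_of_le _ fun i hi => ?_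
    rw [norm_mul, norm_star]
    gcongr
    exact H.small i (Finset.mem_compl.1 hi)

/-- Certificates for the sign pattern of `x` and for the coordinate vectors of its support force `x`
to be the strict `ℓ¹` minimizer on its fibre. -/
theorem norm_sum_lt_of_certificates [DecidableEq ι] {A₀ : Matrix ι ι ℂ} {S : Finset ι} {R : Set ι}
    {δ : ℝ} (hδ : S.card * δ ≤ 1 / 4) {x : ι → ℂ} (hx : ∀ i, i ∉ S → x i = 0)
    (hsgn : ∃ ν, IsCertificate A₀ S R (fun i => x i / (‖x i‖ : ℂ)) δ ν)
    (hone : ∀ u ∈ S, ∃ ν, IsCertificate A₀ S R (Pi.single u 1) δ ν) {h : ι → ℂ} (hne : h ≠ 0)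
    (hh : ∀ k ∈ R, A₀.mulVec h k = 0) : ∑ i, ‖x i‖ < ∑ i, ‖x i + h i‖ := by
  set a : ℝ := ∑ i ∈ S, ‖h i‖ with ha
  set b : ℝ := ∑ i ∈ Sᶜ, ‖h i‖ with hb
  have ha0 : 0 ≤ a := Finset.sum_nonneg fun i _ => norm_nonneg _
  have hb0 : 0 ≤ b := Finset.sum_nonneg fun i _ => norm_nonneg _
  have h1 : ∀ u ∈ S, ‖h u‖ ≤ δ * a + 1 / 3 * b := by
    intro u hu
    obtain ⟨ν, hν⟩ := hone u hu
    have := hν.norm_sum_le hh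
    rwa [Finset.sum_eq_single_of_mem u hu fun i _ hi => by simp [Pi.single_eq_of_ne hi],
      Pi.single_eq_same, star_one, one_mul] at this
  have h2 : a ≤ S.card * (δ * a + 1 / 3 * b) := by
    rw [ha, ← nsmul_eq_mul, ← Finset.sum_const]
    exact Finset.sum_le_sum h1
  -- Since `S.card * δ ≤ 1 / 4`, the term in `a` on the right is absorbed. This replaces a lower
  -- bound for the sampled matrix on `S`.
  have h3 : a ≤ 4 / 9 * S.card * b := by nlinarith
  have hbpos : 0 < b := by
    rcases hb0.eq_or_lt with h0 | h0
    · exfalso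
      apply hne
      have haz : a = 0 := le_antisymm (by simpa [← h0] using h3) ha0
      funext i
      rw [Pi.zero_apply, ← norm_eq_zero]
      by_cases hi : i ∈ S
      · exact (Finset.sum_eq_zero_iff_of_nonneg fun i _ => norm_nonneg _).1 haz i hi
      · exact (Finset.sum_eq_zero_iff_of_nonneg fun i _ => norm_nonneg _).1 h0.symm i
          (Finset.mem_compl.2 hi)
    · exact h0
  obtain ⟨ν, hν⟩ := hsgn
  have hs := hν.norm_sum_le hh
  rw [← ha, ← hb] at hs
  -- Substituting `h3` gives at most `(1 / 9 + 1 / 3) * b` when `δ > 0`, and at most `b / 3`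
  -- otherwise.
  have h4 : ‖∑ i ∈ S, star (x i / (‖x i‖ : ℂ)) * h i‖ < b := by
    rcases le_or_gt δ 0 with hd | hd
    · nlinarith
    · have : δ * a ≤ δ * (4 / 9 * S.card * b) := by gcongr
      nlinarith
  have h5 : ∑ i ∈ S, ‖x i‖ + (∑ i ∈ S, star (x i / (‖x i‖ : ℂ)) * h i).re ≤
      ∑ i ∈ S, ‖x i + h i‖ := by
    rw [Complex.re_sum, ← Finset.sum_add_distrib]
    refine Finset.sum_le_sum fun i _ => ?_
    by_cases hxi : x i = 0
    · simp [hxi]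
    · have hn : (‖x i‖ : ℂ) ≠ 0 := by exact_mod_cast norm_ne_zero_iff.2 hxi
      have e : star (x i / (‖x i‖ : ℂ)) * x i = (‖x i‖ : ℂ) := by
        rw [star_div₀, div_mul_eq_mul_div, div_eq_iff (star_ne_zero.2 hn), mul_comm]
        simp only [RCLike.star_def, Complex.conj_ofReal]
        rw [Complex.mul_conj, Complex.normSq_eq_norm_sq]
        push_cast
        ring
      have hunit : ‖star (x i / (‖x i‖ : ℂ))‖ = 1 := by
        rw [norm_star, norm_div, Complex.norm_real, norm_norm, div_self (norm_ne_zero_iff.2 hxi)]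
      calc ‖x i‖ + (star (x i / (‖x i‖ : ℂ)) * h i).re
          = (star (x i / (‖x i‖ : ℂ)) * (x i + h i)).re := by
            rw [mul_add, e, Complex.add_re, Complex.ofReal_re]
        _ ≤ ‖star (x i / (‖x i‖ : ℂ)) * (x i + h i)‖ := Complex.re_le_norm _
        _ = ‖x i + h i‖ := by rw [norm_mul, hunit, one_mul]
  have h6 : -b < (∑ i ∈ S, star (x i / (‖x i‖ : ℂ)) * h i).re :=
    (abs_lt.1 ((Complex.abs_re_le_norm _).trans_lt h4)).1
  rw [← Finset.sum_add_sum_compl S fun i => ‖x i‖,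
    ← Finset.sum_add_sum_compl S fun i => ‖x i + h i‖]
  have h7 : ∑ i ∈ Sᶜ, ‖x i‖ = 0 := Finset.sum_eq_zero fun i hi => by
    rw [hx i (Finset.mem_compl.1 hi), norm_zero]
  have h8 : ∑ i ∈ Sᶜ, ‖x i + h i‖ = b := Finset.sum_congr rfl fun i hi => by
    rw [hx i (Finset.mem_compl.1 hi), zero_add]
  rw [h7, h8]
  linarith

theorem isUniquelyRecovered_of_certificates [DecidableEq ι] {A₀ : Matrix ι ι ℂ} {π : ι → ℝ}
    (hπ : ∀ k, 0 < π k) {S : Finset ι} {R : Set ι} {δ : ℝ} (hδ : S.card * δ ≤ 1 / 4) {x : ι → ℂ}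
    (hx : ∀ i, i ∉ S → x i = 0)
    (hsgn : ∃ ν, IsCertificate A₀ S R (fun i => x i / (‖x i‖ : ℂ)) δ ν)
    (hone : ∀ u ∈ S, ∃ ν, IsCertificate A₀ S R (Pi.single u 1) δ ν) {m : ℕ} {K : Fin m → ι}
    (hR : R ⊆ Set.range K) : IsUniquelyRecovered (sensingMatrix A₀ π K) x := by
  have key : ∀ z, (sensingMatrix A₀ π K).mulVec z = (sensingMatrix A₀ π K).mulVec x → z ≠ x →
      ∑ i, ‖x i‖ < ∑ i, ‖z i‖ := by
    intro z hz hzx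
    have hh : ∀ k ∈ R, A₀.mulVec (z - x) k = 0 := by
      intro k hk
      obtain ⟨l, rfl⟩ := hR hk
      have hm : 0 < m := l.pos
      have e := congrFun hz l
      have e' : ∀ y, (sensingMatrix A₀ π K).mulVec y l =
          ((1 / Real.sqrt m * (1 / Real.sqrt (π (K l))) : ℝ) : ℂ) * A₀.mulVec y (K l) := by
        intro y
        simp only [Matrix.mulVec, dotProduct, sensingMatrix, Finset.mul_sum, mul_assoc]
      rw [e', e'] at e
      have hne : ((1 / Real.sqrt m * (1 / Real.sqrt (π (K l))) : ℝ) : ℂ) ≠ 0 := by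
        have := Real.sqrt_pos.2 (hπ (K l))
        have : 0 < Real.sqrt m := Real.sqrt_pos.2 (by exact_mod_cast hm)
        exact_mod_cast (by positivity : (0 : ℝ) < 1 / Real.sqrt m * (1 / Real.sqrt (π (K l)))).ne'
      rw [Matrix.mulVec_sub, Pi.sub_apply, mul_left_cancel₀ hne e, sub_self]
    have := norm_sum_lt_of_certificates hδ hx hsgn hone (sub_ne_zero.2 hzx) hh
    simpa using this
  intro z
  constructor
  · rintro ⟨hz, hmin⟩
    by_contra hzx
    exact absurd (hmin x rfl) (not_le.2 (key z hz hzx))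
  · rintro rfl
    refine ⟨rfl, fun w hw => ?_⟩
    by_cases hwz : w = z
    · rw [hwz]
    · exact (key w hw hwz).le

/-- Events about the first `L * m₀` draws, arranged in `L` batches, have at most the mass that the
product weights give them. -/
theorem IsIIDSample.measureReal_le_massOf {Ω : Type*} [MeasurableSpace Ω] [MeasurableSpace ι]
    [MeasurableSingletonClass ι] {μ : Measure Ω} [IsProbabilityMeasure μ] {π : ι → ℝ}
    (hπ : ∀ k, 0 ≤ π k) {m : ℕ} {K : Fin m → Ω → ι} (hK : IsIIDSample μ π K) {L m₀ : ℕ}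
    {e : Fin L × Fin m₀ → Fin m} (he : Function.Injective e) (P : (Fin L → Fin m₀ → ι) → Prop) :
    μ.real {ω | P fun i l => K (e (i, l)) ω} ≤
      massOf (fun b : Fin L → Fin m₀ → ι => ∏ i, ∏ l, π (b i l)) P := by
  classical
  let E : (Fin L → Fin m₀ → ι) → Set Ω := fun b => ⋂ p ∈ Finset.univ, K (e p) ⁻¹' {b p.1 p.2}
  have hE : ∀ b, μ.real (E b) = ∏ i, ∏ l, π (b i l) := by
    intro b
    have := (hK.2.1.precomp he).measure_inter_preimage_eq_mul Finset.univ
      (sets := fun p => {b p.1 p.2}) fun p _ => measurableSet_singleton _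
    rw [Measure.real, this, Finset.prod_congr rfl fun p _ => hK.2.2 (e p) (b p.1 p.2),
      ← ENNReal.ofReal_prod_of_nonneg fun p _ => hπ _,
      ENNReal.toReal_ofReal (Finset.prod_nonneg fun p _ => hπ _), Fintype.prod_prod_type]
  calc μ.real {ω | P fun i l => K (e (i, l)) ω}
      -- Finitely many cylinder events cover the event, so monotonicity and subadditivity suffice
      -- and no measurability of the event is used.
      ≤ μ.real (⋃ b ∈ Finset.univ.filter P, E b) := by
        refine measureReal_mono (fun ω hω => ?_) (measure_ne_top _ _)
        simp only [Set.mem_iUnion, Finset.mem_filter, Finset.mem_univ, true_and]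
        exact ⟨_, hω, by simp [E]⟩
    _ ≤ ∑ b ∈ Finset.univ.filter P, μ.real (E b) := measureReal_biUnion_finset_le _ _
    _ = _ := by
        rw [Finset.sum_filter]
        simp only [hE, massOf]

/-- A union bound over the `S.card + 1` targets, all golfed with the same batches. Draws beyond the
first `L * m₀` are discarded, since further constraints satisfied by `x` do not harm uniqueness. -/
theorem IsIncoherent.le_measureReal_isUniquelyRecovered [DecidableEq ι] [MeasurableSpace ι]
    [MeasurableSingletonClass ι] {A₀ : Matrix ι ι ℂ} {π : ι → ℝ} {S : Finset ι} {Γ : ℝ}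
    (H : IsIncoherent A₀ π S Γ) {x : ι → ℂ} (hx : ∀ i, i ∉ S → x i = 0) {m L m₀ : ℕ}
    (hm : L * m₀ ≤ m) (hm₀ : 0 < m₀) (hs : S.card * (1 / 4 : ℝ) ^ L ≤ 1 / 4) {ε : ℝ}
    (hε : (S.card + 1) * (L * (Fintype.card ι * (4 * Real.exp (-(m₀ / (256 * Γ)))))) ≤ ε)
    {Ω : Type*} [MeasurableSpace Ω] (μ : Measure Ω) [IsProbabilityMeasure μ] {K : Fin m → Ω → ι}
    (hK : IsIIDSample μ π K) :
    1 - ε ≤ μ.real {ω | IsUniquelyRecovered (sensingMatrix A₀ π fun l => K l ω) x} := by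
  let e : Fin L × Fin m₀ → Fin m := fun p => Fin.castLE hm (finProdFinEquiv p)
  have he : Function.Injective e := (Fin.castLE_injective hm).comp finProdFinEquiv.injective
  -- `none` stands for the sign of `x`, which is `0` where `x` vanishes because `0 / 0 = 0`. `some
  -- u` stands for a coordinate vector.
  let v : Option ι → ι → ℂ := fun o => o.elim (fun i => x i / (‖x i‖ : ℂ)) fun u => Pi.single u 1
  let T : Finset (Option ι) := Finset.insertNone S
  have hv : ∀ o ∈ T, IsUnitOn S (v o) := by
    intro o ho
    cases o with
    | none =>
      refine ⟨fun i => ?_, fun i hi => by simp [v, hx i hi]⟩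
      simp only [v, Option.elim, norm_div, Complex.norm_real, norm_norm]
      exact div_self_le_one _
    | some u =>
      have hu : u ∈ S := by simpa [T] using ho
      refine ⟨fun i => ?_, fun i hi => ?_⟩
      · simp only [v, Option.elim, Pi.single_apply]
        split_ifs <;> simp
      · simp only [v, Option.elim]
        exact Pi.single_eq_of_ne (fun h : i = u => hi (by rwa [h])) _
  let Q : Option ι → (Fin L → Fin m₀ → ι) → Prop := fun o b =>
    ¬ ∃ ν, IsCertificate A₀ S {k | ∃ i l, b i l = k} (v o) ((1 / 4) ^ L) ν
  have hbad : massOf (fun b : Fin L → Fin m₀ → ι => ∏ i, ∏ l, π (b i l))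
      (fun b => ∃ o ∈ T, Q o b) ≤ ε := by
    refine (massOf_le_sum (fun b => Finset.prod_nonneg fun i _ => Finset.prod_nonneg fun l _ =>
      (H.pos _).le) T Q fun b hb => hb).trans (le_trans ?_ hε)
    calc _ ≤ ∑ o ∈ T, L * (Fintype.card ι * (4 * Real.exp (-(m₀ / (256 * Γ))))) :=
          Finset.sum_le_sum fun o ho => massOf_no_certificate_le H hm₀ L (hv o ho)
      _ = _ := by
          rw [Finset.sum_const, nsmul_eq_mul, Finset.card_insertNone]
          push_cast
          rfl
  set G := {ω | IsUniquelyRecovered (sensingMatrix A₀ π fun l => K l ω) x} with hG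
  have hGc : μ.real Gᶜ ≤ ε := by
    refine le_trans (measureReal_mono fun ω hω => ?_)
      ((hK.measureReal_le_massOf (fun k => (H.pos k).le) he fun b => ∃ o ∈ T, Q o b).trans hbad)
    by_contra hcon
    apply hω
    have hcert : ∀ o ∈ T, ∃ ν, IsCertificate A₀ S {k | ∃ i l, K (e (i, l)) ω = k} (v o)
        ((1 / 4) ^ L) ν := fun o ho => not_not.1 fun hQ => hcon ⟨o, ho, hQ⟩
    refine isUniquelyRecovered_of_certificates H.pos hs hx (hcert none (by simp [T]))
      (fun u hu => hcert (some u) (by simpa [T] using hu)) ?_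
    rintro k ⟨i, l, rfl⟩
    exact ⟨_, rfl⟩
  have hone : (1 : ℝ) ≤ μ.real G + μ.real Gᶜ := by
    have := measureReal_union_le (μ := μ) G Gᶜ
    rwa [Set.union_compl_self, probReal_univ] at this
  linarith

end Recovery

/-! ### Roots of unity, Parseval in frequency order, and pairings with Haar wavelets. -/

section Entries

theorem two_mul_natAbs_frequency (k : ℕ) :
    k ≤ 2 * (frequency k).natAbs ∧ 2 * (frequency k).natAbs ≤ k + 1 := by
  unfold frequency
  split_ifs with h
  · obtain ⟨a, rfl⟩ := h
    omega
  · rw [Nat.not_even_iff_odd] at h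
    obtain ⟨a, rfl⟩ := h
    omega

theorem lt_two_pow_level (J : ℕ) (k : Fin (2 ^ J)) : (k : ℕ) < 2 ^ (level J k : ℕ) := by
  unfold level
  split_ifs with h
  · simp [h]
  · exact Nat.lt_pow_succ_log_self one_lt_two _

theorem two_pow_level_le {J : ℕ} {k : Fin (2 ^ J)} (hk : (k : ℕ) ≠ 0) :
    2 ^ (level J k : ℕ) ≤ 2 * (k : ℕ) := by
  simp only [level, if_neg hk]
  rw [pow_succ, mul_comm]
  exact Nat.mul_le_mul_left 2 (Nat.pow_log_le_self 2 hk)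

/-- The primitive `2 ^ i`-th root of unity `exp (-2 π i / 2 ^ i)`. -/
noncomputable def rootOfUnity (i : ℕ) : ℂ := Complex.exp (-2 * Real.pi * Complex.I / 2 ^ i)

theorem rootOfUnity_isPrimitiveRoot (i : ℕ) : IsPrimitiveRoot (rootOfUnity i) (2 ^ i) := by
  have h := (Complex.isPrimitiveRoot_exp (2 ^ i) (by positivity)).inv
  rw [← Complex.exp_neg] at h
  have e : rootOfUnity i = Complex.exp (-(2 * Real.pi * Complex.I / (2 ^ i : ℕ))) := by
    rw [rootOfUnity]
    congr 1
    push_cast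
    ring
  rwa [e]

theorem rootOfUnity_ne_zero (i : ℕ) : rootOfUnity i ≠ 0 := Complex.exp_ne_zero _

theorem norm_rootOfUnity (i : ℕ) : ‖rootOfUnity i‖ = 1 := by
  refine (rootOfUnity_isPrimitiveRoot i).norm'_eq_one (by positivity)

theorem rootOfUnity_zpow (i : ℕ) (a : ℤ) :
    rootOfUnity i ^ a = Complex.exp (-2 * Real.pi * Complex.I * a / 2 ^ i) := by
  rw [rootOfUnity, ← Complex.exp_int_mul]
  congr 1
  ring

theorem rootOfUnity_pow_two_pow (i l : ℕ) : rootOfUnity (i + l) ^ 2 ^ l = rootOfUnity i := by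
  rw [rootOfUnity, rootOfUnity, ← Complex.exp_nat_mul]
  congr 1
  push_cast
  rw [pow_add]
  field_simp

theorem norm_one_sub_rootOfUnity_zpow (i : ℕ) (a : ℤ) :
    ‖1 - rootOfUnity i ^ a‖ = 2 * |Real.sin (Real.pi * a / 2 ^ i)| := by
  have e : rootOfUnity i ^ a =
      Complex.exp (Complex.I * ((-(2 * (Real.pi * a / 2 ^ i)) : ℝ) : ℂ)) := by
    rw [rootOfUnity_zpow]
    congr 1
    push_cast
    ring
  rw [norm_sub_rev, e, Complex.norm_exp_I_mul_ofReal_sub_one, neg_div,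
    mul_div_cancel_left₀ _ two_ne_zero, Real.sin_neg, norm_mul, norm_neg]
  simp

/-- The first `2 * N` frequencies are the interval from `1 - N` to `N`, so the sum telescopes. -/
theorem sub_one_mul_sum_zpow_frequency {z : ℂ} (hz : z ≠ 0) (N : ℕ) :
    (z - 1) * ∑ k ∈ Finset.range (2 * N), z ^ frequency k = z ^ (N + 1) - z ^ (1 - N : ℤ) := by
  induction N with
  | zero => simp
  | succ N ih =>
    have h0 : frequency (2 * N) = -(N : ℤ) := by simp [frequency]
    have h1 : frequency (2 * N + 1) = N + 1 := by
      have : ¬ Even (2 * N + 1) := by simp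
      rw [frequency, if_neg this]
      omega
    rw [show 2 * (N + 1) = 2 * N + 1 + 1 by ring, Finset.sum_range_succ, Finset.sum_range_succ,
      mul_add, mul_add, ih, h0, h1]
    have e1 : z ^ (1 - N : ℤ) = z * z ^ (-N : ℤ) := by
      rw [sub_eq_add_neg, zpow_add₀ hz, zpow_one]
    have e2 : z ^ (1 - (N + 1 : ℕ) : ℤ) = z ^ (-N : ℤ) := by
      congr 1
      push_cast
      ring
    have e3 : z ^ (N + 1 : ℤ) = z ^ (N + 1) := by exact_mod_cast zpow_natCast z (N + 1)
    rw [e1, e2, e3]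
    ring

theorem sum_zpow_frequency_eq_zero {z : ℂ} (hz : z ≠ 1) {M : ℕ} (hM : z ^ 2 ^ M = 1) :
    ∑ k ∈ Finset.range (2 ^ M), z ^ frequency k = 0 := by
  have hz0 : z ≠ 0 := by
    rintro rfl
    rw [zero_pow (by positivity)] at hM
    exact zero_ne_one hM
  cases M with
  | zero => simp at hM; exact absurd hM hz
  | succ M =>
    have h := sub_one_mul_sum_zpow_frequency hz0 (2 ^ M)
    rw [← pow_succ'] at h
    have e : z ^ (2 ^ M + 1) = z ^ (1 - (2 ^ M : ℕ) : ℤ) := by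
      have : z ^ (2 ^ M + 1) = z ^ (1 - (2 ^ M : ℕ) : ℤ) * z ^ 2 ^ (M + 1) := by
        rw [← zpow_natCast, ← zpow_natCast, ← zpow_add₀ hz0]
        congr 1
        push_cast
        ring
      rw [this, hM, mul_one]
    rw [e, sub_self] at h
    exact (mul_eq_zero.1 h).resolve_left (sub_ne_zero.2 hz)

theorem sum_rootOfUnity_zpow {i M : ℕ} (hi : i ≤ M) {q r : ℕ} (hq : q < 2 ^ i) (hr : r < 2 ^ i) :
    ∑ k ∈ Finset.range (2 ^ M), rootOfUnity i ^ (frequency k * q) *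
      star (rootOfUnity i ^ (frequency k * r)) = if q = r then 2 ^ M else 0 := by
  have e : ∀ k, rootOfUnity i ^ (frequency k * q) * star (rootOfUnity i ^ (frequency k * r)) =
      (rootOfUnity i ^ (q - r : ℤ)) ^ frequency k := by
    intro k
    have : star (rootOfUnity i ^ (frequency k * r)) = (rootOfUnity i ^ (frequency k * r))⁻¹ := by
      refine (Complex.inv_eq_conj ?_).symm
      rw [norm_zpow, norm_rootOfUnity, one_zpow]
    rw [this, ← zpow_neg, ← zpow_add₀ (rootOfUnity_ne_zero i), ← zpow_mul]
    congr 1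
    ring
  simp_rw [e]
  split_ifs with h
  · subst h
    simp
  · refine sum_zpow_frequency_eq_zero (fun h1 => h ?_) ?_
    · rw [(rootOfUnity_isPrimitiveRoot i).zpow_eq_one_iff_dvd] at h1
      have hlt : |(q - r : ℤ)| < (2 ^ i : ℕ) := by
        rw [abs_lt]
        constructor <;> omega
      have := Int.eq_zero_of_abs_lt_dvd h1 hlt
      omega
    · rw [← zpow_natCast, ← zpow_mul, (rootOfUnity_isPrimitiveRoot i).zpow_eq_one_iff_dvd]
      exact Dvd.dvd.mul_left (by exact_mod_cast pow_dvd_pow 2 hi) _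

/-- Parseval's identity over the first `2 ^ M` frequencies. -/
theorem sum_norm_sq_frequency {i M : ℕ} (hi : i ≤ M) (v : ℕ → ℂ) :
    ∑ k ∈ Finset.range (2 ^ M),
      ‖∑ q ∈ Finset.range (2 ^ i), v q * rootOfUnity i ^ (frequency k * q)‖ ^ 2 =
      2 ^ M * ∑ q ∈ Finset.range (2 ^ i), ‖v q‖ ^ 2 := by
  have hsq : ∀ z : ℂ, ((‖z‖ ^ 2 : ℝ) : ℂ) = z * star z := fun z => by
    rw [RCLike.star_def, Complex.mul_conj, Complex.normSq_eq_norm_sq]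
  rw [← Complex.ofReal_inj, Complex.ofReal_sum, Complex.ofReal_mul, Complex.ofReal_sum]
  simp_rw [hsq, star_sum, Finset.sum_mul_sum]
  rw [Finset.sum_comm, Finset.mul_sum]
  refine Finset.sum_congr rfl fun q hq => ?_
  rw [Finset.sum_comm]
  have e : ∀ r ∈ Finset.range (2 ^ i), ∑ k ∈ Finset.range (2 ^ M),
      v q * rootOfUnity i ^ (frequency k * q) * star (v r * rootOfUnity i ^ (frequency k * r)) =
      v q * star (v r) * if q = r then 2 ^ M else 0 := by
    intro r hr
    rw [← sum_rootOfUnity_zpow hi (Finset.mem_range.1 hq) (Finset.mem_range.1 hr), Finset.mul_sum]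
    refine Finset.sum_congr rfl fun k _ => ?_
    rw [star_mul']
    ring
  rw [Finset.sum_congr rfl e, Finset.sum_eq_single q]
  · simp
    ring
  · intro r _ hrq
    rw [if_neg (Ne.symm hrq), mul_zero]
  · exact fun h => absurd hq h

theorem fourierMatrix_apply (J : ℕ) (k t : Fin (2 ^ J)) :
    fourierMatrix J k t =
      ((1 / Real.sqrt (2 ^ J) : ℝ) : ℂ) * rootOfUnity J ^ (frequency k * ((t : ℕ) : ℤ)) := by
  rw [fourierMatrix, rootOfUnity_zpow]
  congr 2
  push_cast
  ring

theorem sqrt_inv_mul_self (J : ℕ) :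
    ((1 / Real.sqrt (2 ^ J) : ℝ) : ℂ) * ((1 / Real.sqrt (2 ^ J) : ℝ) : ℂ) = 1 / 2 ^ J := by
  rw [← Complex.ofReal_mul, div_mul_div_comm, Real.mul_self_sqrt (by positivity), one_mul]
  push_cast
  rfl

theorem conjTranspose_fourierMatrix_mul_self (J : ℕ) :
    (fourierMatrix J).conjTranspose * fourierMatrix J = 1 := by
  ext t u
  have h := sum_rootOfUnity_zpow (le_refl J) u.isLt t.isLt
  rw [Finset.sum_range] at h
  rw [Matrix.mul_apply, Matrix.one_apply]
  have e : ∀ k, (fourierMatrix J).conjTranspose t k * fourierMatrix J k u =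
      (1 / 2 ^ J) * (rootOfUnity J ^ (frequency k * (u : ℕ)) *
        star (rootOfUnity J ^ (frequency k * (t : ℕ)))) := by
    intro k
    rw [Matrix.conjTranspose_apply, fourierMatrix_apply, fourierMatrix_apply, star_mul',
      ← sqrt_inv_mul_self]
    simp only [RCLike.star_def, Complex.conj_ofReal]
    ring
  rw [Finset.sum_congr rfl fun k _ => e k, ← Finset.mul_sum, h]
  by_cases htu : t = u
  · simp [htu]
  · rw [if_neg htu, if_neg fun h => htu (Fin.ext h.symm), mul_zero]

theorem sum_range_ite_div_eq {n a h : ℕ} (hh : 0 < h) (han : (a + 1) * h ≤ n) (g : ℕ → ℂ) :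
    ∑ t ∈ Finset.range n, (if t / h = a then g t else 0) =
      ∑ r ∈ Finset.range h, g (a * h + r) := by
  have e : (Finset.range n).filter (fun t => t / h = a) = Finset.Ico (a * h) ((a + 1) * h) := by
    ext t
    simp only [Finset.mem_filter, Finset.mem_range, Finset.mem_Ico]
    constructor
    · rintro ⟨_, rfl⟩
      exact ⟨Nat.div_mul_le_self t h, Nat.lt_mul_of_div_lt (Nat.lt_succ_self _) hh⟩
    · rintro ⟨h1, h2⟩
      refine ⟨by omega, le_antisymm (Nat.lt_succ_iff.1 ?_) ?_⟩
      · exact (Nat.div_lt_iff_lt_mul hh).2 h2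
      · exact (Nat.le_div_iff_mul_le hh).2 h1
  rw [← Finset.sum_filter, e, Finset.sum_Ico_eq_sum_range]
  congr 2
  rw [add_mul, one_mul]
  omega

theorem log_two_pow_add {i q : ℕ} (hq : q < 2 ^ i) : Nat.log 2 (2 ^ i + q) = i := by
  have hpos : 0 < 2 ^ i := by positivity
  exact (Nat.log_eq_iff (Or.inr ⟨one_lt_two, by omega⟩)).2 ⟨by omega, by rw [pow_succ]; omega⟩

/-- The value at position `t` of the wavelet of index `2 ^ i + q`. -/
theorem inverseHaarMatrix_apply {J i l q : ℕ} (hJ : J = i + 1 + l) (hq : q < 2 ^ i)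
    {u : Fin (2 ^ J)} (hu : (u : ℕ) = 2 ^ i + q) (t : Fin (2 ^ J)) :
    inverseHaarMatrix J t u = if (t : ℕ) / 2 ^ l = 2 * q then
      ((Real.sqrt (2 ^ i / 2 ^ J) : ℝ) : ℂ) else if (t : ℕ) / 2 ^ l = 2 * q + 1 then
        -((Real.sqrt (2 ^ i / 2 ^ J) : ℝ) : ℂ) else 0 := by
  have hpos : 0 < 2 ^ i := by positivity
  have hlog : Nat.log 2 (u : ℕ) = i := hu ▸ log_two_pow_add hq
  have hl : J - (i + 1) = l := by omega
  have hsub : (u : ℕ) - 2 ^ i = q := by omega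
  simp only [inverseHaarMatrix, if_neg (show (u : ℕ) ≠ 0 by omega), hlog, hl, hsub]

/-- Pairing with the Haar wavelet of index `2 ^ i + q`. -/
theorem sum_mul_inverseHaarMatrix {J i l q : ℕ} (hJ : J = i + 1 + l) (hq : q < 2 ^ i)
    {u : Fin (2 ^ J)} (hu : (u : ℕ) = 2 ^ i + q) (f : ℕ → ℂ) :
    ∑ t : Fin (2 ^ J), f t * inverseHaarMatrix J t u =
      ((Real.sqrt (2 ^ i / 2 ^ J) : ℝ) : ℂ) * (∑ r ∈ Finset.range (2 ^ l), f (2 * q * 2 ^ l + r) -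
        ∑ r ∈ Finset.range (2 ^ l), f ((2 * q + 1) * 2 ^ l + r)) := by
  have hn : 2 ^ J = 2 ^ (i + 1) * 2 ^ l := by rw [hJ, pow_add]
  have hle : 2 * q + 1 + 1 ≤ 2 ^ (i + 1) := by rw [pow_succ]; omega
  set s : ℂ := ((Real.sqrt (2 ^ i / 2 ^ J) : ℝ) : ℂ) with hs
  have hl0 : 0 < 2 ^ l := by positivity
  have e : ∀ t : Fin (2 ^ J), f t * inverseHaarMatrix J t u =
      s * (if (t : ℕ) / 2 ^ l = 2 * q then f t else 0) -
        s * (if (t : ℕ) / 2 ^ l = 2 * q + 1 then f t else 0) := by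
    intro t
    rw [inverseHaarMatrix_apply hJ hq hu]
    by_cases h1 : (t : ℕ) / 2 ^ l = 2 * q
    · rw [if_pos h1, if_pos h1, if_neg (by omega)]
      ring
    · rw [if_neg h1, if_neg h1]
      split_ifs <;> ring
  rw [Finset.sum_congr rfl fun t _ => e t, Finset.sum_sub_distrib, ← Finset.mul_sum,
    ← Finset.mul_sum, ← mul_sub]
  congr 2
  · rw [← sum_range_ite_div_eq (n := 2 ^ J) hl0 _ f]
    · exact (Finset.sum_range fun t => if t / 2 ^ l = 2 * q then f t else 0).symm
    · rw [hn]
      exact Nat.mul_le_mul_right _ (by omega)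
  · rw [← sum_range_ite_div_eq (n := 2 ^ J) hl0 _ f]
    · exact (Finset.sum_range fun t => if t / 2 ^ l = 2 * q + 1 then f t else 0).symm
    · rw [hn]
      exact Nat.mul_le_mul_right _ hle

theorem exists_eq_two_pow_add {J : ℕ} {u : Fin (2 ^ J)} (hu : (u : ℕ) ≠ 0) :
    ∃ i l q, J = i + 1 + l ∧ q < 2 ^ i ∧ (u : ℕ) = 2 ^ i + q := by
  have h1 := Nat.pow_log_le_self 2 hu
  have h2 := Nat.lt_pow_succ_log_self one_lt_two (u : ℕ)
  have h3 : Nat.log 2 (u : ℕ) < J := Nat.log_lt_of_lt_pow hu u.isLt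
  rw [pow_succ] at h2
  exact ⟨Nat.log 2 (u : ℕ), J - (Nat.log 2 (u : ℕ) + 1), (u : ℕ) - 2 ^ Nat.log 2 (u : ℕ),
    by omega, by omega, by omega⟩

theorem level_eq_of_eq {J i q : ℕ} {u : Fin (2 ^ J)} (hq : q < 2 ^ i) (hu : (u : ℕ) = 2 ^ i + q) :
    (level J u : ℕ) = i + 1 := by
  have hpos : 0 < 2 ^ i := by positivity
  have hlog : Nat.log 2 (u : ℕ) = i := hu ▸ log_two_pow_add hq
  simp only [level, if_neg (show (u : ℕ) ≠ 0 by omega), hlog]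

/-- The Haar columns are real-valued. -/
theorem star_inverseHaarMatrix (J : ℕ) (t u : Fin (2 ^ J)) :
    star (inverseHaarMatrix J t u) = inverseHaarMatrix J t u := by
  simp only [inverseHaarMatrix]
  split_ifs <;> simp [-one_div, -Real.sqrt_div', -Complex.ofReal_div]

end Entries

/-! ### Unitarity of the Fourier–Haar matrix, its entries, and decay of the wavelet symbol. -/

section Incoherence

theorem sum_inverseHaarMatrix_mul {J : ℕ} {u v : Fin (2 ^ J)} (huv : (u : ℕ) ≤ v) :
    ∑ t, inverseHaarMatrix J t u * inverseHaarMatrix J t v = if u = v then 1 else 0 := by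
  by_cases hv : (v : ℕ) = 0
  · have hu : (u : ℕ) = 0 := by omega
    rw [if_pos (Fin.ext (hu.trans hv.symm))]
    simp only [inverseHaarMatrix, hu, hv, if_true, sqrt_inv_mul_self]
    simp
  obtain ⟨i', l', q', hJ', hq', hv'⟩ := exists_eq_two_pow_add hv
  by_cases hu : (u : ℕ) = 0
  · have hne : u ≠ v := fun h => hv (h ▸ hu)
    have e : ∀ t, inverseHaarMatrix J t u = ((1 / Real.sqrt (2 ^ J) : ℝ) : ℂ) := fun t => by
      simp only [inverseHaarMatrix, hu, if_true]
    rw [if_neg hne, Finset.sum_congr rfl fun t _ => by rw [e t],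
      sum_mul_inverseHaarMatrix hJ' hq' hv' fun _ => _, sub_self, mul_zero]
  obtain ⟨i, l, q, hJ, hq, hu'⟩ := exists_eq_two_pow_add hu
  set s : ℂ := ((Real.sqrt (2 ^ i / 2 ^ J) : ℝ) : ℂ) with hs
  let f : ℕ → ℂ := fun t => if t / 2 ^ l = 2 * q then s else if t / 2 ^ l = 2 * q + 1 then -s else 0
  have e : ∀ t : Fin (2 ^ J), inverseHaarMatrix J t u = f t :=
    fun t => inverseHaarMatrix_apply hJ hq hu' t
  rw [Finset.sum_congr rfl fun t _ => by rw [e t], sum_mul_inverseHaarMatrix hJ' hq' hv' f]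
  have hii : i ≤ i' := by
    by_contra! hlt
    have := Nat.pow_le_pow_right (n := 2) (by norm_num) (show i' + 1 ≤ i from hlt)
    rw [pow_succ] at this
    omega
  have hdiv : ∀ (a b r : ℕ), r < 2 ^ b → (a * 2 ^ b + r) / 2 ^ b = a := fun a b r hr => by
    rw [mul_comm, Nat.mul_add_div (by positivity), Nat.div_eq_of_lt hr, add_zero]
  rcases hii.eq_or_lt with rfl | hlt
  · have hll : l = l' := by omega
    subst hll
    have h1 : ∀ r ∈ Finset.range (2 ^ l), f (2 * q' * 2 ^ l + r) = if q = q' then s else 0 := by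
      intro r hr
      simp only [f, hdiv _ _ r (Finset.mem_range.1 hr)]
      by_cases h : q = q'
      · rw [if_pos h, if_pos (by omega)]
      · rw [if_neg h, if_neg (by omega), if_neg (by omega)]
    have h2 : ∀ r ∈ Finset.range (2 ^ l), f ((2 * q' + 1) * 2 ^ l + r) =
        if q = q' then -s else 0 := by
      intro r hr
      simp only [f, hdiv _ _ r (Finset.mem_range.1 hr)]
      by_cases h : q = q'
      · rw [if_pos h, if_neg (by omega), if_pos (by omega)]
      · rw [if_neg h, if_neg (by omega), if_neg (by omega)]
    rw [Finset.sum_congr rfl h1, Finset.sum_congr rfl h2]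
    by_cases h : q = q'
    · have huv' : u = v := Fin.ext (by omega)
      have hss : s * s = 2 ^ i / 2 ^ J := by
        rw [hs, ← Complex.ofReal_mul, Real.mul_self_sqrt (by positivity)]
        push_cast
        rfl
      have hJn : (2 : ℂ) ^ J = 2 ^ i * 2 * 2 ^ l := by rw [hJ, pow_add, pow_succ]
      simp only [if_pos h, if_pos huv', Finset.sum_const, Finset.card_range, nsmul_eq_mul]
      calc s * (((2 ^ l : ℕ) : ℂ) * s - ((2 ^ l : ℕ) : ℂ) * -s) = s * s * (2 * 2 ^ l) := by
            push_cast
            ring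
        _ = 1 := by
            rw [hss, hJn]
            field_simp
    · have huv' : u ≠ v := fun h' => h (by rw [h'] at hu'; omega)
      simp only [if_neg h, if_neg huv', sub_self, mul_zero]
  · have huv' : u ≠ v := by
      rintro rfl
      have := Nat.pow_le_pow_right (n := 2) (by norm_num) (show i + 1 ≤ i' from hlt)
      rw [pow_succ] at this
      omega
    obtain ⟨d, rfl⟩ : ∃ d, l = l' + 1 + d := ⟨l - (l' + 1), by omega⟩
    -- The coarser wavelet is constant on the support of the finer one, whose two halves therefore
    -- cancel.
    have h1 : ∀ r ∈ Finset.range (2 ^ l'), f (2 * q' * 2 ^ l' + r) =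
        f ((2 * q' + 1) * 2 ^ l' + r) := by
      intro r hr
      simp only [f, pow_add _ (l' + 1) d, pow_add _ l' 1, pow_one, ← Nat.div_div_eq_div_mul,
        hdiv _ _ r (Finset.mem_range.1 hr)]
      rw [show (2 * q' + 1) / 2 = 2 * q' / 2 by omega]
    rw [Finset.sum_congr rfl h1, sub_self, mul_zero, if_neg huv']

theorem conjTranspose_inverseHaarMatrix_mul_self (J : ℕ) :
    (inverseHaarMatrix J).conjTranspose * inverseHaarMatrix J = 1 := by
  ext u v
  rw [Matrix.mul_apply, Matrix.one_apply]
  simp only [Matrix.conjTranspose_apply, star_inverseHaarMatrix]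
  rcases le_total (u : ℕ) v with h | h
  · exact sum_inverseHaarMatrix_mul h
  · rw [Finset.sum_congr rfl fun t _ => mul_comm _ _, sum_inverseHaarMatrix_mul h]
    simp only [eq_comm]

theorem fourierHaarMatrix_isometry {J : ℕ} (w : Fin (2 ^ J) → ℂ) (i : Fin (2 ^ J)) :
    ∑ k, star (fourierHaarMatrix J k i) * (fourierHaarMatrix J).mulVec w k = w i := by
  have h : (fourierHaarMatrix J).conjTranspose * fourierHaarMatrix J = 1 := by
    rw [fourierHaarMatrix, Matrix.conjTranspose_mul, Matrix.mul_assoc,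
      ← Matrix.mul_assoc (fourierMatrix J).conjTranspose,
      conjTranspose_fourierMatrix_mul_self, Matrix.one_mul,
      conjTranspose_inverseHaarMatrix_mul_self]
  have h2 := congrFun (congrArg (fun M => Matrix.mulVec M w) h) i
  simp only [Matrix.one_mulVec, ← Matrix.mulVec_mulVec] at h2
  exact h2

/-- The modulating factor of the Fourier transforms of the wavelets of scale `i`, for signals of
length `2 ^ (i + 1 + l)`. -/
noncomputable def haarSymbol (i l : ℕ) (a : ℤ) : ℂ :=
  ((1 / Real.sqrt (2 ^ (i + 1 + l)) : ℝ) : ℂ) * ((Real.sqrt (2 ^ i / 2 ^ (i + 1 + l)) : ℝ) : ℂ) *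
    ((1 - rootOfUnity (i + 1) ^ a) *
      ∑ r ∈ Finset.range (2 ^ l), (rootOfUnity (i + 1 + l) ^ a) ^ r)

/-- Wavelets of one scale are translates of each other by `2 ^ (l + 1)`, and translation becomes
modulation by a power of `rootOfUnity i`. The common factor is the symbol. -/
theorem fourierHaarMatrix_apply {i l q : ℕ} (hq : q < 2 ^ i)
    {u : Fin (2 ^ (i + 1 + l))} (hu : (u : ℕ) = 2 ^ i + q) (k : Fin (2 ^ (i + 1 + l))) :
    fourierHaarMatrix (i + 1 + l) k u =
      haarSymbol i l (frequency k) * rootOfUnity i ^ (frequency k * q) := by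
  set a := frequency k with ha
  have h := sum_mul_inverseHaarMatrix rfl hq hu
    fun t => ((1 / Real.sqrt (2 ^ (i + 1 + l)) : ℝ) : ℂ) * rootOfUnity (i + 1 + l) ^ (a * (t : ℤ))
  have e0 : rootOfUnity (i + 1 + l) ≠ 0 := rootOfUnity_ne_zero _
  have e1 : rootOfUnity (i + 1 + l) ^ ((2 ^ l : ℕ) : ℤ) = rootOfUnity (i + 1) := by
    rw [zpow_natCast, rootOfUnity_pow_two_pow]
  have e2 : rootOfUnity (i + 1) ^ (2 : ℤ) = rootOfUnity i := by
    have := rootOfUnity_pow_two_pow i 1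
    rw [pow_one] at this
    exact_mod_cast this
  have h1 : ∀ r : ℕ, rootOfUnity (i + 1 + l) ^ (a * ((2 * q * 2 ^ l + r : ℕ) : ℤ)) =
      rootOfUnity i ^ (a * q) * (rootOfUnity (i + 1 + l) ^ a) ^ r := by
    intro r
    rw [← e2, ← e1, ← zpow_mul, ← zpow_mul, ← zpow_natCast, ← zpow_mul, ← zpow_add₀ e0]
    congr 1
    push_cast
    ring
  have h2 : ∀ r : ℕ, rootOfUnity (i + 1 + l) ^ (a * (((2 * q + 1) * 2 ^ l + r : ℕ) : ℤ)) =
      rootOfUnity i ^ (a * q) * (rootOfUnity (i + 1) ^ a *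
        (rootOfUnity (i + 1 + l) ^ a) ^ r) := by
    intro r
    rw [← e2, ← e1, ← zpow_mul, ← zpow_mul, ← zpow_mul, ← zpow_natCast, ← zpow_mul,
      ← zpow_add₀ e0, ← zpow_add₀ e0]
    congr 1
    push_cast
    ring
  rw [fourierHaarMatrix, Matrix.mul_apply, Finset.sum_congr rfl fun t _ => by
    rw [fourierMatrix_apply], h]
  simp only [h1, h2, ← Finset.mul_sum]
  rw [haarSymbol]
  ring

theorem fourierHaarMatrix_apply_zero {J : ℕ} {u : Fin (2 ^ J)} (hu : (u : ℕ) = 0)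
    (k : Fin (2 ^ J)) : fourierHaarMatrix J k u = if (k : ℕ) = 0 then 1 else 0 := by
  have hH : ∀ t, inverseHaarMatrix J t u = ((1 / Real.sqrt (2 ^ J) : ℝ) : ℂ) := fun t => by
    simp only [inverseHaarMatrix, hu, if_true]
  have e : ∀ t : Fin (2 ^ J), fourierMatrix J k t * inverseHaarMatrix J t u =
      1 / 2 ^ J * (rootOfUnity J ^ frequency k) ^ (t : ℕ) := fun t => by
    rw [fourierMatrix_apply, hH, ← sqrt_inv_mul_self, zpow_mul, zpow_natCast]
    ring
  rw [fourierHaarMatrix, Matrix.mul_apply, Finset.sum_congr rfl fun t _ => e t, ← Finset.mul_sum,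
    ← Finset.sum_range fun t => (rootOfUnity J ^ frequency k) ^ t]
  have hf := two_mul_natAbs_frequency k
  split_ifs with hk
  · have : frequency k = 0 := by omega
    simp [this]
  · have hne : rootOfUnity J ^ frequency k ≠ 1 := by
      rw [Ne, (rootOfUnity_isPrimitiveRoot J).zpow_eq_one_iff_dvd]
      intro hd
      have h1 := Int.eq_zero_of_abs_lt_dvd hd (by
        have := k.isLt
        rw [← Int.natCast_natAbs]
        omega)
      omega
    have hone : (rootOfUnity J ^ frequency k) ^ 2 ^ J = 1 := by
      rw [← zpow_natCast, ← zpow_mul, (rootOfUnity_isPrimitiveRoot J).zpow_eq_one_iff_dvd]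
      exact Dvd.intro_left _ rfl
    have hg := mul_neg_geom_sum (rootOfUnity J ^ frequency k) (2 ^ J)
    rw [hone, sub_self] at hg
    rw [(mul_eq_zero.1 hg).resolve_left (sub_ne_zero.2 hne.symm), mul_zero]

theorem haarSymbol_zero (i l : ℕ) : haarSymbol i l 0 = 0 := by simp [haarSymbol]

/-- With `Z = rootOfUnity (i + 1 + l) ^ a` and `W = Z ^ 2 ^ l`, the geometric sum makes `(1 - Z) *
haarSymbol` a constant times `(1 - W) ^ 2`. Jordan's inequality bounds `|1 - Z|` below by `4 * |a| /
n`, which is where `|a| ≤ n / 2` enters. -/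
theorem norm_haarSymbol_sq_le {i l : ℕ} {a : ℤ} (hlt : 2 * |(a : ℝ)| ≤ 2 ^ (i + 1 + l)) :
    16 * (a : ℝ) ^ 2 * ‖haarSymbol i l a‖ ^ 2 ≤
      2 ^ i * ‖1 - rootOfUnity (i + 1) ^ a‖ ^ 4 := by
  set n : ℝ := 2 ^ (i + 1 + l) with hn
  have hn0 : 0 < n := by positivity
  set Z := rootOfUnity (i + 1 + l) ^ a with hZ
  set W := rootOfUnity (i + 1) ^ a with hW
  have hgeo : (1 - Z) * ∑ r ∈ Finset.range (2 ^ l), Z ^ r = 1 - W := by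
    rw [mul_neg_geom_sum, hZ, hW, ← rootOfUnity_pow_two_pow (i + 1) l, ← zpow_natCast,
      ← zpow_natCast, ← zpow_mul, ← zpow_mul, mul_comm]
  have hZn : 4 * |(a : ℝ)| / n ≤ ‖1 - Z‖ := by
    rw [hZ, norm_one_sub_rootOfUnity_zpow, ← hn]
    have habs : |Real.pi * a / n| = Real.pi * |(a : ℝ)| / n := by
      rw [abs_div, abs_mul, abs_of_pos Real.pi_pos, abs_of_pos hn0]
    have := Real.mul_abs_le_abs_sin (x := Real.pi * a / n) (by
      rw [habs, div_le_div_iff₀ hn0 two_pos]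
      nlinarith [Real.pi_pos])
    rw [habs] at this
    calc 4 * |(a : ℝ)| / n = 2 * (2 / Real.pi * (Real.pi * |(a : ℝ)| / n)) := by
          have := Real.pi_ne_zero
          field_simp
          ring
      _ ≤ _ := by gcongr
  have hsym : ‖1 - Z‖ ^ 2 * ‖haarSymbol i l a‖ ^ 2 = 2 ^ i / n ^ 2 * ‖1 - W‖ ^ 4 := by
    have e : (1 - Z) * haarSymbol i l a = (((1 / Real.sqrt n) * Real.sqrt (2 ^ i / n) : ℝ) : ℂ) *
        (1 - W) ^ 2 := by
      rw [haarSymbol, ← hZ, ← hW, sq, ← hn]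
      nth_rw 3 [← hgeo]
      push_cast
      ring
    rw [← mul_pow, ← norm_mul, e, norm_mul, norm_pow, Complex.norm_real, Real.norm_of_nonneg
      (by positivity), mul_pow, mul_pow, div_pow, Real.sq_sqrt hn0.le, Real.sq_sqrt (by positivity)]
    field_simp
  have h1 : (4 * |(a : ℝ)| / n) ^ 2 * ‖haarSymbol i l a‖ ^ 2 ≤ 2 ^ i / n ^ 2 * ‖1 - W‖ ^ 4 := by
    rw [← hsym]
    gcongr
  rw [div_pow, mul_pow, sq_abs, div_mul_eq_mul_div, div_mul_eq_mul_div,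
    div_le_div_iff_of_pos_right (by positivity)] at h1
  linarith

theorem decay_comm {J : ℕ} (j p : Fin (J + 1)) : decay j p = decay p j := by
  rw [decay, decay, abs_sub_comm]

theorem decay_pos {J : ℕ} (j p : Fin (J + 1)) : 0 < decay j p := by
  rw [decay]
  positivity

theorem decay_le_one {J : ℕ} (j p : Fin (J + 1)) : decay j p ≤ 1 := by
  rw [decay]
  refine Real.rpow_le_one_of_one_le_of_nonpos one_le_two ?_
  have := abs_nonneg (((j : ℕ) : ℝ) - ((p : ℕ) : ℝ))
  linarith

theorem decay_sq {J : ℕ} {j p : Fin (J + 1)} (h : (p : ℕ) ≤ j) :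
    decay j p ^ 2 = 2 ^ (p : ℕ) / 2 ^ (j : ℕ) := by
  have h' : ((p : ℕ) : ℝ) ≤ (j : ℕ) := by exact_mod_cast h
  rw [decay, ← Real.rpow_natCast, ← Real.rpow_mul two_pos.le, abs_of_nonneg (sub_nonneg.2 h'),
    ← Real.rpow_natCast, ← Real.rpow_natCast, ← Real.rpow_sub two_pos]
  congr 1
  push_cast
  ring

/-- The factor `2 ^ max` is the one produced by Parseval in `sum_level_norm_sq_le`, so that it
cancels there. On a level `j ≥ 1` the frequency satisfies `2 ^ j / 4 ≤ |a| ≤ 2 ^ j / 2`. -/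
theorem haarSymbol_level_bound {i l : ℕ} (k : Fin (2 ^ (i + 1 + l)))
    {p : Fin (i + 1 + l + 1)} (hp : (p : ℕ) = i + 1) :
    ‖haarSymbol i l (frequency k)‖ ^ 2 * 2 ^ max (level _ k : ℕ) (i + 1) ≤
      16 * decay (level _ k) p ^ 2 := by
  by_cases hk : (k : ℕ) = 0
  · have : frequency k = 0 := by
      have := two_mul_natAbs_frequency k
      omega
    rw [this, haarSymbol_zero]
    have := decay_pos (level _ k) p
    simp
    positivity
  set j := level _ k with hj
  set a := frequency k with ha
  have hf := two_mul_natAbs_frequency k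
  have habs : ((a.natAbs : ℕ) : ℝ) = |(a : ℝ)| := by
    rw [Nat.cast_natAbs, Int.cast_abs]
  have h1 : (2 : ℝ) ^ (j : ℕ) ≤ 4 * |(a : ℝ)| := by
    rw [← habs]
    have := two_pow_level_le hk
    exact_mod_cast this.trans (by omega)
  have h2 : 2 * |(a : ℝ)| ≤ 2 ^ (j : ℕ) := by
    rw [← habs]
    have := lt_two_pow_level _ k
    exact_mod_cast hf.2.trans this
  have hle : (2 : ℝ) ^ (j : ℕ) ≤ 2 ^ (i + 1 + l) :=
    pow_le_pow_right₀ one_le_two (Nat.lt_succ_iff.1 j.isLt)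
  have hmain := norm_haarSymbol_sq_le (i := i) (l := l) (a := a) (h2.trans hle)
  set X := ‖haarSymbol i l a‖ ^ 2 with hX
  have hX0 : 0 ≤ X := by positivity
  have ha0 : 0 < |(a : ℝ)| := by
    have : (0 : ℝ) < 2 ^ (j : ℕ) := by positivity
    linarith
  have hasq : (a : ℝ) ^ 2 = |(a : ℝ)| ^ 2 := (sq_abs _).symm
  rw [hasq] at hmain
  set b := |(a : ℝ)| with hb
  set Y := ‖1 - rootOfUnity (i + 1) ^ a‖ with hY
  have hY0 : 0 ≤ Y := norm_nonneg _
  set A : ℝ := 2 ^ (j : ℕ) with hA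
  have hA0 : 0 < A := by positivity
  set B : ℝ := 2 ^ (i + 1) with hB
  have hB0 : 0 < B := by positivity
  have hBi : (2 : ℝ) ^ i = B / 2 := by rw [hB, pow_succ]; ring
  rw [hBi] at hmain
  -- Frequencies above the wavelet scale: `|1 - W| ≤ 2` and the factor `1 / a ^ 2` gives the decay.
  -- Below it, `|1 - W| = O(|a| / B)` beats that factor and leaves a spare power of `A / B`.
  rcases le_or_gt (i + 1) (j : ℕ) with hij | hij
  · rw [max_eq_left hij, decay_sq (by omega), hp, ← hA, ← hB]
    have hY2 : Y ≤ 2 := by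
      have := norm_sub_le (1 : ℂ) (rootOfUnity (i + 1) ^ a)
      rw [norm_zpow, norm_rootOfUnity, one_zpow, norm_one] at this
      linarith
    have hY4 : Y ^ 4 ≤ 16 := by
      calc Y ^ 4 ≤ 2 ^ 4 := by gcongr
        _ = 16 := by norm_num
    have h3 : A ^ 2 * X ≤ 16 * b ^ 2 * X := by
      have : A ^ 2 ≤ (4 * b) ^ 2 := by gcongr
      nlinarith
    have h4 : B / 2 * Y ^ 4 ≤ B / 2 * 16 := by gcongr
    rw [mul_div_assoc', le_div_iff₀ hA0]
    nlinarith
  · rw [max_eq_right hij.le, decay_comm, decay_sq (by omega), hp, ← hA, ← hB]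
    have hYb : Y ≤ 2 * Real.pi * b / B := by
      rw [hY, norm_one_sub_rootOfUnity_zpow, ← hB]
      have := Real.abs_sin_le_abs (x := Real.pi * a / B)
      rw [abs_div, abs_mul, abs_of_pos Real.pi_pos, abs_of_pos hB0, ← hb] at this
      calc 2 * |Real.sin (Real.pi * a / B)| ≤ 2 * (Real.pi * b / B) := by gcongr
        _ = _ := by ring
    have hpi4 : Real.pi ^ 4 ≤ 100 := by
      calc Real.pi ^ 4 ≤ 3.15 ^ 4 := by
            gcongr
            exact Real.pi_lt_d2.le
        _ ≤ 100 := by norm_num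
    have hY4 : Y ^ 4 ≤ 16 * 100 * b ^ 4 / B ^ 4 := by
      calc Y ^ 4 ≤ (2 * Real.pi * b / B) ^ 4 := by gcongr
        _ = 16 * Real.pi ^ 4 * b ^ 4 / B ^ 4 := by ring
        _ ≤ _ := by gcongr
    have h3 : 16 * b ^ 2 * X ≤ 16 * b ^ 2 * (50 * b ^ 2 / B ^ 3) := by
      refine hmain.trans ?_
      calc B / 2 * Y ^ 4 ≤ B / 2 * (16 * 100 * b ^ 4 / B ^ 4) := by gcongr
        _ = _ := by
          field_simp
          ring
    have h4 : X ≤ 50 * b ^ 2 / B ^ 3 := le_of_mul_le_mul_left h3 (by positivity)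
    have h5 : b ^ 2 ≤ A ^ 2 / 4 := by nlinarith
    have hAB : A ≤ B := pow_le_pow_right₀ one_le_two hij.le
    calc X * B ≤ 50 * b ^ 2 / B ^ 3 * B := by gcongr
      _ = 50 * b ^ 2 / B ^ 2 := by field_simp
      _ ≤ 50 * (A ^ 2 / 4) / B ^ 2 := by gcongr
      _ = 12.5 * (A / B) * (A / B) := by field_simp; norm_num
      _ ≤ 12.5 * (A / B) * 1 := by
        gcongr
        exact (div_le_one hB0).2 hAB
      _ ≤ 16 * (A / B) := by
        have : 0 ≤ A / B := by positivity
        linarith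

end Incoherence

/-! ### Operator norms of level blocks, and the incoherence constants. -/

section Blocks

theorem level_eq_zero_iff {J : ℕ} {u : Fin (2 ^ J)} : (level J u : ℕ) = 0 ↔ (u : ℕ) = 0 := by
  simp only [level]
  split_ifs with h <;> simp [h]

theorem exists_of_level_eq {J i : ℕ} {u : Fin (2 ^ J)} (hu : (level J u : ℕ) = i + 1) :
    ∃ q, q < 2 ^ i ∧ (u : ℕ) = 2 ^ i + q := by
  have hu0 : (u : ℕ) ≠ 0 := fun h => by
    rw [level_eq_zero_iff.2 h] at hu
    omega
  obtain ⟨i', l, q, -, hq, hu'⟩ := exists_eq_two_pow_add hu0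
  have := level_eq_of_eq hq hu'
  obtain rfl : i' = i := by omega
  exact ⟨q, hq, hu'⟩

theorem sum_level_succ {M : Type*} [AddCommMonoid M] {i l : ℕ} {p : Fin (i + 1 + l + 1)}
    (hp : (p : ℕ) = i + 1) (G : ℕ → M) :
    ∑ u : Fin (2 ^ (i + 1 + l)) with level _ u = p, G u =
      ∑ q ∈ Finset.range (2 ^ i), G (2 ^ i + q) := by
  have hle : 2 ^ i + 2 ^ i ≤ 2 ^ (i + 1 + l) := by
    calc 2 ^ i + 2 ^ i = 2 ^ (i + 1) := by ring
      _ ≤ _ := Nat.pow_le_pow_right (by norm_num) (by omega)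
  refine (Finset.sum_bij (fun q hq => (⟨2 ^ i + q, ?_⟩ : Fin (2 ^ (i + 1 + l)))) ?_ ?_ ?_ ?_).symm
  · have := Finset.mem_range.1 hq
    omega
  · intro q hq
    rw [Finset.mem_filter]
    refine ⟨Finset.mem_univ _, Fin.ext ?_⟩
    rw [hp]
    exact level_eq_of_eq (Finset.mem_range.1 hq) rfl
  · intro q _ r _ h
    simpa using h
  · intro u hu
    obtain ⟨q, hq, hu'⟩ := exists_of_level_eq (u := u) (i := i) (by
      rw [(Finset.mem_filter.1 hu).2, hp])
    exact ⟨q, Finset.mem_range.2 hq, Fin.ext hu'.symm⟩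
  · intro q _
    rfl

/-- The block of the Fourier-Haar matrix with rows in level `j` and columns in level `p` has
operator norm at most `4 * decay j p`. -/
theorem sum_level_norm_sq_le {J : ℕ} (j p : Fin (J + 1)) (v : Fin (2 ^ J) → ℂ) :
    ∑ k with level J k = j, ‖∑ u with level J u = p, fourierHaarMatrix J k u * v u‖ ^ 2 ≤
      16 * decay j p ^ 2 * ∑ u with level J u = p, ‖v u‖ ^ 2 := by
  by_cases hp : (p : ℕ) = 0
  · let u₀ : Fin (2 ^ J) := ⟨0, by positivity⟩
    have hfil : ∀ j' : Fin (J + 1), (j' : ℕ) = 0 →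
        (Finset.univ.filter fun u => level J u = j') = {u₀} := by
      intro j' hj'
      ext u
      simp only [Finset.mem_filter, Finset.mem_univ, true_and, Finset.mem_singleton]
      rw [Fin.ext_iff, hj', level_eq_zero_iff, Fin.ext_iff]
    rw [hfil p hp, Finset.sum_singleton]
    simp only [Finset.sum_singleton]
    by_cases hj : (j : ℕ) = 0
    · rw [hfil j hj, Finset.sum_singleton, fourierHaarMatrix_apply_zero (u := u₀) rfl,
        if_pos rfl, one_mul, decay_sq (by omega), hp, hj]
      have : 0 ≤ ‖v u₀‖ ^ 2 := by positivity
      norm_num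
      linarith
    · refine le_trans (le_of_eq (Finset.sum_eq_zero fun k hk => ?_)) (by positivity)
      rw [fourierHaarMatrix_apply_zero (u := u₀) rfl, if_neg, zero_mul, norm_zero]
      · norm_num
      · rw [← level_eq_zero_iff, (Finset.mem_filter.1 hk).2]
        exact hj
  · obtain ⟨i, l, hi, rfl⟩ : ∃ i l, (p : ℕ) = i + 1 ∧ J = i + 1 + l :=
      ⟨p - 1, J - p, by omega, by have := p.isLt; omega⟩
    let v' : ℕ → ℂ := fun t => if h : t < 2 ^ (i + 1 + l) then v ⟨t, h⟩ else 0
    have hv' : ∀ u : Fin (2 ^ (i + 1 + l)), v u = v' u := fun u => by simp [v']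
    let V : ℤ → ℂ := fun a =>
      ∑ q ∈ Finset.range (2 ^ i), v' (2 ^ i + q) * rootOfUnity i ^ (a * q)
    have hinner : ∀ k, ∑ u with level _ u = p, fourierHaarMatrix (i + 1 + l) k u * v u =
        haarSymbol i l (frequency k) * V (frequency k) := by
      intro k
      have h := sum_level_succ hi fun u => haarSymbol i l (frequency k) *
        rootOfUnity i ^ (frequency k * ((u - 2 ^ i : ℕ) : ℤ)) * v' u
      rw [Finset.sum_congr rfl (g := fun u : Fin (2 ^ (i + 1 + l)) => haarSymbol i l (frequency k) *
        rootOfUnity i ^ (frequency k * (((u : ℕ) - 2 ^ i : ℕ) : ℤ)) * v' u), h]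
      · simp only [V, Finset.mul_sum, Nat.add_sub_cancel_left]
        exact Finset.sum_congr rfl fun q _ => by ring
      · intro u hu
        obtain ⟨q, hq, hu'⟩ := exists_of_level_eq (u := u) (i := i) (by
          rw [(Finset.mem_filter.1 hu).2, hi])
        rw [fourierHaarMatrix_apply hq hu', hv', hu', Nat.add_sub_cancel_left]
    have hnorm : ∑ u with level _ u = p, ‖v u‖ ^ 2 =
        ∑ q ∈ Finset.range (2 ^ i), ‖v' (2 ^ i + q)‖ ^ 2 := by
      rw [← sum_level_succ hi fun u => ‖v' u‖ ^ 2]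
      exact Finset.sum_congr rfl fun u _ => by rw [hv']
    -- Parseval needs `M ≥ i`, and rows of level `j` lie among the first `2 ^ M` only if `M ≥ j`.
    set M := max (j : ℕ) (i + 1) with hM
    have hpars := sum_norm_sq_frequency (i := i) (M := M)
      ((Nat.le_succ i).trans (le_max_right _ _)) fun q => v' (2 ^ i + q)
    have hrange : ∑ k : Fin (2 ^ (i + 1 + l)) with level _ k = j, ‖V (frequency k)‖ ^ 2 ≤
        ∑ k ∈ Finset.range (2 ^ M), ‖V (frequency k)‖ ^ 2 := by
      have hmap := Finset.sum_map (Finset.univ.filter fun k => level (i + 1 + l) k = j)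
        Fin.valEmbedding fun k => ‖V (frequency k)‖ ^ 2
      simp only [Fin.valEmbedding_apply] at hmap
      rw [← hmap]
      refine Finset.sum_le_sum_of_subset_of_nonneg ?_ fun _ _ _ => by positivity
      intro t ht
      obtain ⟨k, hk, rfl⟩ := Finset.mem_map.1 ht
      rw [Finset.mem_range, Fin.valEmbedding_apply]
      refine (lt_two_pow_level _ k).trans_le (Nat.pow_le_pow_right (by norm_num) ?_)
      rw [(Finset.mem_filter.1 hk).2]
      exact le_max_left _ _
    have h2M : (0 : ℝ) < 2 ^ M := by positivity
    calc _ = ∑ k : Fin (2 ^ (i + 1 + l)) with level _ k = j,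
          ‖haarSymbol i l (frequency k)‖ ^ 2 * ‖V (frequency k)‖ ^ 2 :=
          Finset.sum_congr rfl fun k _ => by rw [hinner, norm_mul, mul_pow]
      _ ≤ ∑ k : Fin (2 ^ (i + 1 + l)) with level _ k = j,
          16 * decay j p ^ 2 / 2 ^ M * ‖V (frequency k)‖ ^ 2 := by
          refine Finset.sum_le_sum fun k hk => ?_
          gcongr
          rw [le_div_iff₀ h2M]
          have := haarSymbol_level_bound k hi
          rwa [(Finset.mem_filter.1 hk).2] at this
      _ ≤ 16 * decay j p ^ 2 / 2 ^ M * (2 ^ M * ∑ u with level _ u = p, ‖v u‖ ^ 2) := by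
          rw [← Finset.mul_sum, hnorm, ← hpars]
          gcongr
      _ = _ := by field_simp

theorem norm_fourierHaarMatrix_sq_le {J : ℕ} (k u : Fin (2 ^ J)) :
    ‖fourierHaarMatrix J k u‖ ^ 2 ≤
      16 * decay (level J k) (level J u) ^ 2 / 2 ^ (level J k : ℕ) := by
  have hd := decay_pos (level J k) (level J u)
  by_cases hu : (u : ℕ) = 0
  · rw [fourierHaarMatrix_apply_zero hu]
    split_ifs with hk
    · rw [decay_sq (by rw [level_eq_zero_iff.2 hu]; omega), level_eq_zero_iff.2 hu,
        level_eq_zero_iff.2 hk]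
      norm_num
    · rw [norm_zero, zero_pow two_ne_zero]
      positivity
  · obtain ⟨i, l, q, rfl, hq, hu'⟩ := exists_eq_two_pow_add hu
    rw [fourierHaarMatrix_apply hq hu', norm_mul, norm_zpow, norm_rootOfUnity, one_zpow, mul_one,
      le_div_iff₀ (by positivity)]
    refine le_trans ?_ (haarSymbol_level_bound k (level_eq_of_eq hq hu'))
    gcongr
    · exact one_le_two
    · exact le_max_left _ _

theorem norm_fourierHaarMatrix_le {J : ℕ} (k u : Fin (2 ^ J)) :
    ‖fourierHaarMatrix J k u‖ ≤
      4 / Real.sqrt (2 ^ (level J k : ℕ)) * decay (level J k) (level J u) := by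
  have hd := decay_pos (level J k) (level J u)
  refine le_of_sq_le_sq ((norm_fourierHaarMatrix_sq_le k u).trans (le_of_eq ?_)) (by positivity)
  rw [mul_pow, div_pow, Real.sq_sqrt (by positivity)]
  ring

/-- Each side of `j` is dominated by a geometric series of ratio `2 ^ (-1 / 2) ≤ 3 / 4`, hence by
`4`. -/
theorem sum_decay_le {J : ℕ} (j : Fin (J + 1)) : ∑ p, decay j p ≤ 8 := by
  set r : ℝ := (2 : ℝ) ^ (-(1 / 2) : ℝ) with hr
  have hr0 : 0 < r := by positivity
  have hr2 : r ^ 2 = 1 / 2 := by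
    rw [hr, ← Real.rpow_natCast, ← Real.rpow_mul two_pos.le]
    norm_num
  have hr1 : r ≤ 3 / 4 := by nlinarith
  have hsum : Summable fun n : ℕ => r ^ n := summable_geometric_of_lt_one hr0.le (by linarith)
  have htsum : ∑' n : ℕ, r ^ n ≤ 4 := by
    rw [tsum_geometric_of_lt_one hr0.le (by linarith), inv_le_comm₀ (by linarith) (by norm_num)]
    linarith
  have key : ∀ (s : Finset (Fin (J + 1))) (d : Fin (J + 1) → ℕ), Set.InjOn d s →
      ∑ p ∈ s, r ^ d p ≤ 4 := by
    intro s d hd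
    rw [← Finset.sum_image (f := fun n : ℕ => r ^ n) hd]
    exact (hsum.sum_le_tsum _ fun n _ => by positivity).trans htsum
  rw [← Finset.sum_filter_add_sum_filter_not Finset.univ fun p : Fin (J + 1) => (p : ℕ) ≤ j]
  have h1 : ∀ p ∈ Finset.univ.filter fun p : Fin (J + 1) => (p : ℕ) ≤ j,
      decay j p = r ^ ((j : ℕ) - (p : ℕ)) := by
    intro p hp
    have hp' := (Finset.mem_filter.1 hp).2
    rw [decay, hr, ← Real.rpow_natCast, ← Real.rpow_mul two_pos.le, Nat.cast_sub hp',
      abs_of_nonneg (sub_nonneg.2 (by exact_mod_cast hp'))]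
    congr 1
    ring
  have h2 : ∀ p ∈ Finset.univ.filter fun p : Fin (J + 1) => ¬ (p : ℕ) ≤ j,
      decay j p = r ^ ((p : ℕ) - (j : ℕ)) := by
    intro p hp
    have hp' := (not_le.1 (Finset.mem_filter.1 hp).2).le
    rw [decay, hr, ← Real.rpow_natCast, ← Real.rpow_mul two_pos.le, Nat.cast_sub hp',
      abs_of_nonpos (sub_nonpos.2 (by exact_mod_cast hp'))]
    congr 1
    ring
  rw [Finset.sum_congr rfl h1, Finset.sum_congr rfl h2]
  have h3 := key (Finset.univ.filter fun p : Fin (J + 1) => (p : ℕ) ≤ j)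
    (fun p => (j : ℕ) - (p : ℕ)) (by
      intro p hp q hq h
      simp only [Finset.coe_filter, Finset.mem_univ, true_and] at hp hq
      change (p : ℕ) ≤ j at hp
      change (q : ℕ) ≤ j at hq
      exact Fin.ext (by dsimp only at h; omega))
  have h4 := key (Finset.univ.filter fun p : Fin (J + 1) => ¬ (p : ℕ) ≤ j)
    (fun p => (p : ℕ) - (j : ℕ)) (by
      intro p hp q hq h
      simp only [Finset.coe_filter, Finset.mem_univ, true_and] at hp hq
      change ¬ (p : ℕ) ≤ j at hp
      change ¬ (q : ℕ) ≤ j at hq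
      exact Fin.ext (by dsimp only at h; omega))
  linarith

/-- The sum `∑_p 2 ^ (-|j - p| / 2) * s_p`. -/
noncomputable def decayedSparsity {J : ℕ} (S : Finset (Fin (2 ^ J))) (j : Fin (J + 1)) : ℝ :=
  ∑ p : Fin (J + 1), decay j p * (levelSparsity S p : ℝ)

theorem sum_decay_eq_decayedSparsity {J : ℕ} (S : Finset (Fin (2 ^ J))) (j : Fin (J + 1)) :
    ∑ u ∈ S, decay j (level J u) = decayedSparsity S j := by
  rw [decayedSparsity, ← Finset.sum_fiberwise S (level J)]
  refine Finset.sum_congr rfl fun p _ => ?_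
  rw [Finset.sum_congr rfl fun u hu => by rw [(Finset.mem_filter.1 hu).2], Finset.sum_const,
    nsmul_eq_mul, mul_comm]
  rfl

theorem decayedSparsity_pos {J : ℕ} {S : Finset (Fin (2 ^ J))} (hS : S.Nonempty)
    (j : Fin (J + 1)) : 0 < decayedSparsity S j := by
  rw [← sum_decay_eq_decayedSparsity]
  exact Finset.sum_pos (fun u _ => decay_pos _ _) hS

theorem norm_mulVec_le {J : ℕ} {S : Finset (Fin (2 ^ J))} {v : Fin (2 ^ J) → ℂ}
    (hv : IsUnitOn S v) (k : Fin (2 ^ J)) :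
    ‖(fourierHaarMatrix J).mulVec v k‖ ≤
      4 / Real.sqrt (2 ^ (level J k : ℕ)) * decayedSparsity S (level J k) := by
  rw [Matrix.mulVec, dotProduct, ← sum_decay_eq_decayedSparsity, Finset.mul_sum,
    ← Finset.sum_subset (Finset.subset_univ S) fun u _ hu => by rw [hv.2 u hu, mul_zero]]
  refine norm_sum_le_of_le _ fun u _ => ?_
  rw [norm_mul]
  refine (mul_le_of_le_one_right (norm_nonneg _) (hv.1 u)).trans (norm_fourierHaarMatrix_le k u)

/-- Cauchy–Schwarz over column levels with weights `decay j p` uses up one of the two powers of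
`decay` in the squared block norm. The other yields a bound linear in `decayedSparsity`, which
summing the entrywise bound would not give. -/
theorem sum_level_norm_mulVec_sq_le {J : ℕ} {S : Finset (Fin (2 ^ J))} {v : Fin (2 ^ J) → ℂ}
    (hv : IsUnitOn S v) (j : Fin (J + 1)) :
    ∑ k with level J k = j, ‖(fourierHaarMatrix J).mulVec v k‖ ^ 2 ≤ 128 * decayedSparsity S j := by
  set g : Fin (2 ^ J) → Fin (J + 1) → ℂ := fun k p =>
    ∑ u with level J u = p, fourierHaarMatrix J k u * v u with hg
  have hsplit : ∀ k, (fourierHaarMatrix J).mulVec v k = ∑ p, g k p := fun k =>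
    (Finset.sum_fiberwise Finset.univ (level J) fun u => fourierHaarMatrix J k u * v u).symm
  have hcs : ∀ k, ‖(fourierHaarMatrix J).mulVec v k‖ ^ 2 ≤
      8 * ∑ p, ‖g k p‖ ^ 2 / decay j p := by
    intro k
    calc ‖(fourierHaarMatrix J).mulVec v k‖ ^ 2 ≤ (∑ p, ‖g k p‖) ^ 2 := by
          rw [hsplit]
          gcongr
          exact norm_sum_le _ _
      _ ≤ (∑ p, decay j p) * ∑ p, ‖g k p‖ ^ 2 / decay j p :=
          Finset.sum_sq_le_sum_mul_sum_of_sq_le_mul _ (fun p _ => (decay_pos j p).le)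
            (fun p _ => div_nonneg (sq_nonneg _) (decay_pos j p).le)
            fun p _ => (mul_div_cancel₀ _ (decay_pos j p).ne').ge
      _ ≤ _ := by
          gcongr
          · exact Finset.sum_nonneg fun p _ => div_nonneg (sq_nonneg _) (decay_pos j p).le
          · exact sum_decay_le j
  have hmass : ∀ p, ∑ u with level J u = p, ‖v u‖ ^ 2 ≤ (levelSparsity S p : ℝ) := by
    intro p
    calc ∑ u with level J u = p, ‖v u‖ ^ 2 = ∑ u ∈ S with level J u = p, ‖v u‖ ^ 2 := by
          refine (Finset.sum_subset (Finset.filter_subset_filter _ (Finset.subset_univ S))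
            fun u hu hu' => ?_).symm
          have : u ∉ S := fun h => hu' (Finset.mem_filter.2 ⟨h, (Finset.mem_filter.1 hu).2⟩)
          rw [hv.2 u this, norm_zero]
          norm_num
      _ ≤ ∑ u ∈ S with level J u = p, (1 : ℝ) :=
          Finset.sum_le_sum fun u _ => pow_le_one₀ (norm_nonneg _) (hv.1 u)
      _ = _ := by simp [levelSparsity]
  calc _ ≤ ∑ k with level J k = j, 8 * ∑ p, ‖g k p‖ ^ 2 / decay j p :=
        Finset.sum_le_sum fun k _ => hcs k
    _ = 8 * ∑ p, (∑ k with level J k = j, ‖g k p‖ ^ 2) / decay j p := by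
        rw [← Finset.mul_sum, Finset.sum_comm]
        simp_rw [Finset.sum_div]
    _ ≤ 8 * ∑ p, 16 * (decay j p * (levelSparsity S p : ℝ)) := by
        gcongr with p
        rw [div_le_iff₀ (decay_pos j p)]
        refine (sum_level_norm_sq_le j p v).trans ?_
        have := mul_le_mul_of_nonneg_left (hmass p)
          (show 0 ≤ 16 * decay j p ^ 2 by positivity)
        linarith
    _ = _ := by
        rw [decayedSparsity, ← Finset.mul_sum]
        ring

theorem samplingBound_eq {J : ℕ} (S : Finset (Fin (2 ^ J))) (w : Fin (J + 1) → ℝ) :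
    samplingBound S w = ⨆ j, decayedSparsity S j / (2 ^ (j : ℕ) * w j) := by
  unfold samplingBound decayedSparsity
  congr 1
  ext j
  rw [one_div_mul_one_div, mul_comm (w j), one_div_mul_eq_div]

theorem decayedSparsity_div_le {J : ℕ} (S : Finset (Fin (2 ^ J))) (w : Fin (J + 1) → ℝ)
    (j : Fin (J + 1)) : decayedSparsity S j / (2 ^ (j : ℕ) * w j) ≤ samplingBound S w := by
  rw [samplingBound_eq]
  exact le_ciSup (f := fun j : Fin (J + 1) => decayedSparsity S j / (2 ^ (j : ℕ) * w j))
    (Set.finite_range _).bddAbove j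

/-- The Fourier-Haar matrix is incoherent with constant `2 ^ 14 * samplingBound S w`. -/
theorem isIncoherent_fourierHaarMatrix {J : ℕ} {S : Finset (Fin (2 ^ J))} (hS : S.Nonempty)
    {w : Fin (J + 1) → ℝ} (hw : IsLevelDistribution J w) :
    IsIncoherent (fourierHaarMatrix J) (fun k => w (level J k)) S
      (16384 * samplingBound S w) := by
  set B := samplingBound S w with hB
  have hwpos := hw.1
  have hT : ∀ j, 0 < decayedSparsity S j := decayedSparsity_pos hS
  have hTB : ∀ j : Fin (J + 1), decayedSparsity S j / (2 ^ (j : ℕ) * w j) ≤ B :=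
    decayedSparsity_div_le S w
  have hB0 : 0 ≤ B := (div_pos (hT 0) (mul_pos (by positivity) (hwpos 0))).le.trans (hTB 0)
  have hvar : ∀ v, IsUnitOn S v → ∀ i, ∑ k, ‖fourierHaarMatrix J k i‖ ^ 2 *
      ‖(fourierHaarMatrix J).mulVec v k‖ ^ 2 / w (level J k) ≤ 16384 * B := by
    intro v hv i
    rw [← Finset.sum_fiberwise Finset.univ (level J)]
    calc _ ≤ ∑ j : Fin (J + 1), 2048 * B * decay (level J i) j := by
          refine Finset.sum_le_sum fun j _ => ?_
          have hwj := hwpos j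
          have hd := decay_pos j (level J i)
          calc _ ≤ ∑ k with level J k = j, 16 * decay j (level J i) / 2 ^ (j : ℕ) / w j *
                ‖(fourierHaarMatrix J).mulVec v k‖ ^ 2 := by
                refine Finset.sum_le_sum fun k hk => ?_
                have hk' := (Finset.mem_filter.1 hk).2
                have h1 := norm_fourierHaarMatrix_sq_le k i
                rw [hk'] at h1
                rw [hk', mul_div_right_comm]
                have h2 : decay j (level J i) ^ 2 ≤ decay j (level J i) := by
                  have := decay_le_one j (level J i)
                  nlinarith
                gcongr
                refine h1.trans ?_
                gcongr
            _ ≤ 16 * decay j (level J i) / 2 ^ (j : ℕ) / w j * (128 * decayedSparsity S j) := by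
                rw [← Finset.mul_sum]
                gcongr
                exact sum_level_norm_mulVec_sq_le hv j
            _ = 2048 * (decayedSparsity S j / (2 ^ (j : ℕ) * w j)) * decay (level J i) j := by
                rw [decay_comm (level J i) j]
                field_simp
                ring
            _ ≤ _ := by
                have := decay_pos (level J i) j
                gcongr
                exact hTB j
      _ = 2048 * B * ∑ j, decay (level J i) j := by rw [Finset.mul_sum]
      _ ≤ 2048 * B * 8 := by
          gcongr
          exact sum_decay_le _
      _ = _ := by ring
  refine ⟨fun k => hwpos _, hw.2, ?_, fourierHaarMatrix_isometry, fun v hv k i => ?_, hvar⟩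
  · obtain ⟨u, hu⟩ := hS
    have hone : IsUnitOn S (Pi.single u (1 : ℂ)) := by
      refine ⟨fun i => ?_, fun i hi => Pi.single_eq_of_ne (fun h : i = u => hi (by rwa [h])) _⟩
      rw [Pi.single_apply]
      split_ifs <;> simp
    refine le_trans ?_ (hvar _ hone u)
    have hiso := fourierHaarMatrix_isometry (Pi.single u (1 : ℂ)) u
    have hcol : ∀ k, (fourierHaarMatrix J).mulVec (Pi.single u 1) k = fourierHaarMatrix J k u :=
      fun k => by rw [Matrix.mulVec_single_one, Matrix.col_apply]
    simp_rw [hcol, Pi.single_eq_same] at hiso ⊢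
    have hsum : ∑ k, ‖fourierHaarMatrix J k u‖ ^ 2 = 1 := by
      rw [← Complex.ofReal_inj, Complex.ofReal_sum, Complex.ofReal_one, ← hiso]
      refine Finset.sum_congr rfl fun k _ => ?_
      rw [RCLike.star_def, mul_comm, Complex.mul_conj, Complex.normSq_eq_norm_sq]
    -- `1 ≤ Γ` comes from the variance at `v = e_u`: a unit column gives `1 = (∑ |A_ku| ^ 2) ^ 2 ≤
    -- (∑ π_k) * ∑ |A_ku| ^ 4 / π_k`.
    have hcs := Finset.sum_sq_le_sum_mul_sum_of_sq_le_mul Finset.univ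
      (r := fun k => ‖fourierHaarMatrix J k u‖ ^ 2) (f := fun k => w (level J k))
      (g := fun k => ‖fourierHaarMatrix J k u‖ ^ 2 * ‖fourierHaarMatrix J k u‖ ^ 2 / w (level J k))
      (fun k _ => (hwpos _).le)
      (fun k _ => div_nonneg (by positivity) (hwpos _).le)
      (fun k _ => by
        refine le_of_eq ?_
        have := (hwpos (level J k)).ne'
        field_simp)
    rw [hsum, hw.2] at hcs
    linarith
  · have hwk := hwpos (level J k)
    have h1 := norm_fourierHaarMatrix_le k i
    have h2 := norm_mulVec_le hv k
    have h3 : ‖fourierHaarMatrix J k i‖ ≤ 4 / Real.sqrt (2 ^ (level J k : ℕ)) :=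
      h1.trans (mul_le_of_le_one_right (by positivity) (decay_le_one _ _))
    calc _ ≤ 4 / Real.sqrt (2 ^ (level J k : ℕ)) * (4 / Real.sqrt (2 ^ (level J k : ℕ)) *
          decayedSparsity S (level J k)) / w (level J k) := by gcongr
      _ = 16 * (decayedSparsity S (level J k) / (2 ^ (level J k : ℕ) * w (level J k))) := by
          rw [← mul_assoc, div_mul_div_comm, Real.mul_self_sqrt (by positivity)]
          field_simp
          ring
      _ ≤ 16 * B := by
          gcongr
          exact hTB _
      _ ≤ 16384 * B := by linarith

end Blocks

/-! ### The optimal distribution and the sample count. -/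

section Sampling

/-- The normalizing constant of the optimal distribution. -/
noncomputable def totalWeight {J : ℕ} (S : Finset (Fin (2 ^ J))) : ℝ :=
  ∑ k : Fin (2 ^ J), 1 / 2 ^ (level J k : ℕ) * decayedSparsity S (level J k)

theorem totalWeight_pos {J : ℕ} {S : Finset (Fin (2 ^ J))} (hS : S.Nonempty) :
    0 < totalWeight S :=
  Finset.sum_pos (fun k _ => mul_pos (by positivity) (decayedSparsity_pos hS _))
    ⟨⟨0, by positivity⟩, Finset.mem_univ _⟩

theorem optimalWeight_eq {J : ℕ} (S : Finset (Fin (2 ^ J))) (j : Fin (J + 1)) :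
    optimalWeight S j = 1 / 2 ^ (j : ℕ) * decayedSparsity S j / totalWeight S := rfl

theorem isLevelDistribution_optimalWeight {J : ℕ} {S : Finset (Fin (2 ^ J))} (hS : S.Nonempty) :
    IsLevelDistribution J (optimalWeight S) := by
  have hZ := totalWeight_pos hS
  refine ⟨fun j => ?_, ?_⟩
  · rw [optimalWeight_eq]
    have := decayedSparsity_pos hS j
    positivity
  · simp_rw [optimalWeight_eq]
    rw [← Finset.sum_div]
    exact div_self hZ.ne'

theorem samplingBound_optimalWeight {J : ℕ} {S : Finset (Fin (2 ^ J))} (hS : S.Nonempty) :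
    samplingBound S (optimalWeight S) = totalWeight S := by
  have hZ := totalWeight_pos hS
  rw [samplingBound_eq]
  have : ∀ j : Fin (J + 1), decayedSparsity S j / (2 ^ (j : ℕ) * optimalWeight S j) =
      totalWeight S := fun j => by
    have := decayedSparsity_pos hS j
    rw [optimalWeight_eq]
    field_simp
  simp_rw [this]
  exact ciSup_const

theorem decayedSparsity_le_mul {J : ℕ} {S : Finset (Fin (2 ^ J))} {w : Fin (J + 1) → ℝ}
    (hw : ∀ j, 0 < w j) (j : Fin (J + 1)) :
    1 / 2 ^ (j : ℕ) * decayedSparsity S j ≤ samplingBound S w * w j := by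
  have h := decayedSparsity_div_le S w j
  have := hw j
  rw [div_le_iff₀ (by positivity)] at h
  rw [one_div_mul_eq_div, div_le_iff₀ (by positivity)]
  linarith

theorem totalWeight_le_samplingBound {J : ℕ} {S : Finset (Fin (2 ^ J))} {w : Fin (J + 1) → ℝ}
    (hw : IsLevelDistribution J w) : totalWeight S ≤ samplingBound S w := by
  calc totalWeight S ≤ ∑ k : Fin (2 ^ J), samplingBound S w * w (level J k) :=
        Finset.sum_le_sum fun k _ => decayedSparsity_le_mul hw.1 _
    _ = samplingBound S w := by rw [← Finset.mul_sum, hw.2, mul_one]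

theorem exists_level_eq {J : ℕ} (j : Fin (J + 1)) : ∃ k, level J k = j := by
  by_cases hj : (j : ℕ) = 0
  · exact ⟨⟨0, by positivity⟩, Fin.ext (by rw [hj, level_eq_zero_iff])⟩
  · obtain ⟨i, hi⟩ : ∃ i, (j : ℕ) = i + 1 := ⟨j - 1, by omega⟩
    refine ⟨⟨2 ^ i, Nat.pow_lt_pow_right one_lt_two (by have := j.isLt; omega)⟩, Fin.ext ?_⟩
    exact (level_eq_of_eq (q := 0) (by positivity) rfl).trans hi.symm

/-- Equality of the sums forces equality in every term of `decayedSparsity_le_mul`. Since every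
level contains a row, this determines `w`. -/
theorem eq_optimalWeight_of_samplingBound_eq {J : ℕ} {S : Finset (Fin (2 ^ J))} (hS : S.Nonempty)
    {w : Fin (J + 1) → ℝ} (hw : IsLevelDistribution J w)
    (h : samplingBound S w = samplingBound S (optimalWeight S)) : w = optimalWeight S := by
  rw [samplingBound_optimalWeight hS] at h
  have hZ := totalWeight_pos hS
  have hsum : ∑ k : Fin (2 ^ J), 1 / 2 ^ (level J k : ℕ) * decayedSparsity S (level J k) =
      ∑ k : Fin (2 ^ J), samplingBound S w * w (level J k) := by
    rw [← Finset.mul_sum, hw.2, mul_one, h]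
    rfl
  have heq := (Finset.sum_eq_sum_iff_of_le fun k _ =>
    decayedSparsity_le_mul (S := S) hw.1 (level J k)).1 hsum
  funext j
  obtain ⟨k, rfl⟩ := exists_level_eq j
  rw [optimalWeight_eq, heq k (Finset.mem_univ _), h, mul_div_cancel_left₀ _ hZ.ne']

theorem card_level_le {J : ℕ} (j : Fin (J + 1)) :
    (Finset.univ.filter fun k => level J k = j).card ≤ 2 ^ (j : ℕ) := by
  rw [← Finset.card_range (2 ^ (j : ℕ)), ← Finset.card_map Fin.valEmbedding]
  refine Finset.card_le_card fun t ht => ?_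
  obtain ⟨k, hk, rfl⟩ := Finset.mem_map.1 ht
  rw [Finset.mem_range, Fin.valEmbedding_apply, ← (Finset.mem_filter.1 hk).2]
  exact lt_two_pow_level _ k

theorem totalWeight_le_sum_decayedSparsity {J : ℕ} {S : Finset (Fin (2 ^ J))} (hS : S.Nonempty) :
    totalWeight S ≤ ∑ j, decayedSparsity S j := by
  rw [totalWeight, ← Finset.sum_fiberwise Finset.univ (level J)]
  refine Finset.sum_le_sum fun j _ => ?_
  rw [Finset.sum_congr rfl fun k hk => by rw [(Finset.mem_filter.1 hk).2], Finset.sum_const,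
    nsmul_eq_mul, ← mul_assoc]
  refine mul_le_of_le_one_left (decayedSparsity_pos hS j).le ?_
  rw [mul_one_div, div_le_one (by positivity)]
  exact_mod_cast card_level_le j

theorem decay_self {J : ℕ} (j : Fin (J + 1)) : decay j j = 1 := by simp [decay]

theorem sum_levelSparsity_add_eq {J : ℕ} (S : Finset (Fin (2 ^ J))) (j : Fin (J + 1)) :
    (levelSparsity S j : ℝ) + ∑ p ∈ Finset.univ.erase j, decay j p * (levelSparsity S p : ℝ) =
      decayedSparsity S j := by
  rw [decayedSparsity, ← Finset.add_sum_erase _ _ (Finset.mem_univ j), decay_self, one_mul]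

/-- `L = ⌊log₂ s⌋ + 2` works, as `4 ^ L ≥ 4 * s ^ 2`. The bound `L ≤ 2 * s` only serves the final
crude count. -/
theorem exists_batches {s : ℕ} (hs : 2 ≤ s) :
    ∃ L : ℕ, 0 < L ∧ (L : ℝ) ≤ 5 * Real.log s ∧ L ≤ 2 * s ∧
      (s : ℝ) * (1 / 4 : ℝ) ^ L ≤ 1 / 4 := by
  have hs0 : s ≠ 0 := by omega
  have hlow := Nat.pow_log_le_self 2 hs0
  have hupp := Nat.lt_pow_succ_log_self one_lt_two s
  have hlt := Nat.log_lt_self 2 hs0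
  refine ⟨Nat.log 2 s + 2, by omega, ?_, by omega, ?_⟩
  · have hl2 := Real.log_two_gt_d9
    have h1 : (Nat.log 2 s : ℝ) * Real.log 2 ≤ Real.log s := by
      rw [← Real.log_pow]
      exact Real.log_le_log (by positivity) (by exact_mod_cast hlow)
    have h2 : (1 : ℝ) ≤ Nat.log 2 s := by
      exact_mod_cast (Nat.log_pos one_lt_two hs)
    push_cast
    nlinarith
  · rw [one_div_pow, mul_one_div, div_le_div_iff₀ (by positivity) (by norm_num)]
    have h4 : 4 ^ (Nat.log 2 s + 2) = 4 * 2 ^ (Nat.log 2 s + 1) * 2 ^ (Nat.log 2 s + 1) := by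
      rw [show 4 = 2 ^ 2 by norm_num, ← pow_mul]
      ring
    have : s * 4 ≤ 4 ^ (Nat.log 2 s + 2) := by
      rw [h4]
      have h1 : s ≤ 2 ^ (Nat.log 2 s + 1) := hupp.le
      have h2 := Nat.le_mul_of_pos_right (2 ^ (Nat.log 2 s + 1))
        (show 0 < 2 ^ (Nat.log 2 s + 1) by positivity)
      calc s * 4 ≤ 2 ^ (Nat.log 2 s + 1) * 2 ^ (Nat.log 2 s + 1) * 4 :=
            Nat.mul_le_mul_right 4 (h1.trans h2)
        _ = _ := by ring
    rw [one_mul]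
    exact_mod_cast this

/-- Recovery from enough draws under a level-constant distribution. -/
theorem le_measureReal_isUniquelyRecovered {J : ℕ} {S : Finset (Fin (2 ^ J))} (hS : 2 ≤ S.card)
    {w : Fin (J + 1) → ℝ} (hw : IsLevelDistribution J w) {x : Fin (2 ^ J) → ℂ}
    (hx : ∀ i, i ∉ S → x i = 0) {ε : ℝ} (hε0 : 0 < ε) (hε1 : ε < 1) {m : ℕ}
    (hm : 2 ^ 29 * samplingBound S w * Real.log S.card * Real.log (2 ^ J / ε) ≤ (m : ℝ))
    {Ω : Type*} [MeasurableSpace Ω] (μ : Measure Ω) [IsProbabilityMeasure μ]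
    {K : Fin m → Ω → Fin (2 ^ J)} (hK : IsIIDSample μ (fun k => w (level J k)) K) :
    1 - ε ≤ μ.real {ω | IsUniquelyRecovered
      (sensingMatrix (fourierHaarMatrix J) (fun k => w (level J k)) (fun l => K l ω)) x} := by
  have hne : S.Nonempty := Finset.card_pos.1 (by omega)
  have H := isIncoherent_fourierHaarMatrix hne hw
  set Γ := 16384 * samplingBound S w with hΓ
  have hΓ1 : 1 ≤ Γ := H.one_le
  obtain ⟨L, hL0, hLlog, hLs, hLδ⟩ := exists_batches hS
  have hsn : S.card ≤ 2 ^ J := by simpa using Finset.card_le_univ S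
  set n : ℝ := 2 ^ J with hn
  have hsn' : (S.card : ℝ) ≤ n := by
    rw [hn]
    exact_mod_cast hsn
  have hs2 : (2 : ℝ) ≤ S.card := by exact_mod_cast hS
  have hn2 : 2 ≤ n := hs2.trans hsn'
  have hnε : 2 ≤ n / ε := by
    rw [le_div_iff₀ hε0]
    nlinarith
  set ℓ := Real.log (n / ε) with hℓ
  have hℓ1 : 1 / 2 ≤ ℓ := by
    have := Real.log_le_log two_pos hnε
    have := Real.log_two_gt_d9
    linarith
  have hLr : (0 : ℝ) < L := by exact_mod_cast hL0
  -- The constant: `5` from the batch count, `2 ^ 12` per batch and `2 ^ 14` in `Γ` give `5 * 2 ^ 26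
  -- ≤ 2 ^ 29`.
  have hbudget : (L : ℝ) * (2 ^ 12 * (Γ * ℓ)) ≤ m := by
    have h0 : 0 ≤ 2 ^ 12 * (Γ * ℓ) := by positivity
    have hlog0 : 0 ≤ Real.log S.card := Real.log_nonneg (by linarith)
    calc (L : ℝ) * (2 ^ 12 * (Γ * ℓ)) ≤ 5 * Real.log S.card * (2 ^ 12 * (Γ * ℓ)) := by gcongr
      _ = 5 * 2 ^ 26 * samplingBound S w * Real.log S.card * ℓ := by rw [hΓ]; ring
      _ ≤ 2 ^ 29 * samplingBound S w * Real.log S.card * ℓ := by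
          have hB0 : 0 ≤ samplingBound S w := by linarith
          gcongr
          norm_num
      _ ≤ m := hm
  have hΓℓ : 1 / 2 ≤ Γ * ℓ := by nlinarith
  -- Halving the constant pays for rounding down. Then `2 ^ 11 / 256 = 8` is the power of `ε / n`
  -- gained below, ample against the polynomial union bound.
  have hm₀ : 2 ^ 11 * (Γ * ℓ) ≤ ((m / L : ℕ) : ℝ) := by
    have h1 : (m : ℝ) < L * ((m / L : ℕ) + 1) := by
      exact_mod_cast Nat.lt_mul_div_succ m hL0
    have h2 := lt_of_mul_lt_mul_left (hbudget.trans_lt h1) hLr.le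
    linarith
  have hm₀pos : 0 < m / L := by
    have : (0 : ℝ) < ((m / L : ℕ) : ℝ) := by linarith
    exact_mod_cast this
  refine H.le_measureReal_isUniquelyRecovered hx (Nat.mul_div_le m L) hm₀pos hLδ ?_ μ hK
  have hexp : Real.exp (-(((m / L : ℕ) : ℝ) / (256 * Γ))) ≤ (ε / n) ^ 8 := by
    have h1 : 8 * ℓ ≤ ((m / L : ℕ) : ℝ) / (256 * Γ) := by
      rw [le_div_iff₀ (by positivity)]
      linarith
    calc Real.exp (-(((m / L : ℕ) : ℝ) / (256 * Γ))) ≤ Real.exp (-(8 * ℓ)) :=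
          Real.exp_le_exp.2 (neg_le_neg h1)
      _ = (Real.exp (-ℓ)) ^ 8 := by
          rw [← Real.exp_nat_mul]
          congr 1
          push_cast
          ring
      _ = (ε / n) ^ 8 := by
          rw [hℓ, ← Real.log_inv, Real.exp_log (by positivity), inv_div]
  have hcard : (Fintype.card (Fin (2 ^ J)) : ℝ) = n := by simp [hn]
  have hLn : (L : ℝ) ≤ 2 * n := by
    have : (L : ℝ) ≤ 2 * S.card := by exact_mod_cast hLs
    linarith
  rw [hcard]
  calc _ ≤ (n + n) * (2 * n * (n * (4 * (ε / n) ^ 8))) := by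
        gcongr
        linarith
    _ = 16 * ε ^ 8 / n ^ 5 := by
        field_simp
        ring
    _ ≤ ε := by
        rw [div_le_iff₀ (by positivity)]
        have h1 : (2 : ℝ) ^ 5 ≤ n ^ 5 := by gcongr
        have h2 : ε ^ 8 ≤ ε := pow_le_of_le_one hε0.le hε1.le (by norm_num)
        nlinarith

end Sampling

end FourierHaar

theorem mainTheorem5 :
    ∃ C : ℝ, 0 < C ∧
      ∀ (J : ℕ) (S : Finset (Fin (2 ^ J))), 2 ≤ S.card →
        -- recovery for an arbitrary level-constant distribution
        (∀ (w : Fin (J + 1) → ℝ), FourierHaar.IsLevelDistribution J w →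
          ∀ (x : Fin (2 ^ J) → ℂ), (∀ i, i ∉ S → x i = 0) →
          ∀ (ε : ℝ), 0 < ε → ε < 1 →
          ∀ (m : ℕ),
            C * FourierHaar.samplingBound S w * Real.log S.card * Real.log (2 ^ J / ε) ≤ (m : ℝ) →
          ∀ (Ω : Type*) [MeasurableSpace Ω] (μ : Measure Ω) [IsProbabilityMeasure μ]
            (K : Fin m → Ω → Fin (2 ^ J)),
            FourierHaar.IsIIDSample μ (fun k => w (FourierHaar.level J k)) K →
            1 - ε ≤ μ.real {ω | FourierHaar.IsUniquelyRecovered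
              (FourierHaar.sensingMatrix (FourierHaar.fourierHaarMatrix J)
                (fun k => w (FourierHaar.level J k)) (fun l => K l ω)) x}) ∧
        -- the optimal level-constant distribution is the unique minimizer of the bound
        (FourierHaar.IsLevelDistribution J (FourierHaar.optimalWeight S) ∧
          ∀ (w : Fin (J + 1) → ℝ), FourierHaar.IsLevelDistribution J w →
            FourierHaar.samplingBound S (FourierHaar.optimalWeight S) ≤
                FourierHaar.samplingBound S w ∧
              (FourierHaar.samplingBound S w =
                FourierHaar.samplingBound S (FourierHaar.optimalWeight S) →
                  w = FourierHaar.optimalWeight S)) ∧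
        -- recovery for the optimal distribution
        (∀ (x : Fin (2 ^ J) → ℂ), (∀ i, i ∉ S → x i = 0) →
          ∀ (ε : ℝ), 0 < ε → ε < 1 →
          ∀ (m : ℕ),
            C * (∑ j : Fin (J + 1), ((FourierHaar.levelSparsity S j : ℝ) +
                ∑ p ∈ Finset.univ.erase j,
                  FourierHaar.decay j p * (FourierHaar.levelSparsity S p : ℝ))) *
              Real.log S.card * Real.log (2 ^ J / ε) ≤ (m : ℝ) →
          ∀ (Ω : Type*) [MeasurableSpace Ω] (μ : Measure Ω) [IsProbabilityMeasure μ]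
            (K : Fin m → Ω → Fin (2 ^ J)),
            FourierHaar.IsIIDSample μ
              (fun k => FourierHaar.optimalWeight S (FourierHaar.level J k)) K →
            1 - ε ≤ μ.real {ω | FourierHaar.IsUniquelyRecovered
              (FourierHaar.sensingMatrix (FourierHaar.fourierHaarMatrix J)
                (fun k => FourierHaar.optimalWeight S (FourierHaar.level J k))
                (fun l => K l ω)) x}) := by
  refine ⟨2 ^ 29, by positivity, fun J S hS => ?_⟩
  have hne : S.Nonempty := Finset.card_pos.1 (by omega)
  have hopt := FourierHaar.isLevelDistribution_optimalWeight hne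
  refine ⟨fun w hw x hx ε hε0 hε1 m hm Ω _ μ _ K hK =>
    FourierHaar.le_measureReal_isUniquelyRecovered hS hw hx hε0 hε1 hm μ hK,
    ⟨hopt, fun w hw => ⟨?_, FourierHaar.eq_optimalWeight_of_samplingBound_eq hne hw⟩⟩,
    fun x hx ε hε0 hε1 m hm Ω _ μ _ K hK =>
      FourierHaar.le_measureReal_isUniquelyRecovered hS hopt hx hε0 hε1 (le_trans ?_ hm) μ hK⟩
  · rw [FourierHaar.samplingBound_optimalWeight hne]
    exact FourierHaar.totalWeight_le_samplingBound hw
  -- Part (iii) is part (i) at the optimal weights: a level `j` has at most `2 ^ j` rows, so the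
  -- normalizing constant is at most `∑ j, decayedSparsity S j`.
  · have hs1 : (1 : ℝ) ≤ S.card := by exact_mod_cast hne.card_pos
    have hlog : 0 ≤ Real.log S.card := Real.log_nonneg hs1
    have hlog' : 0 ≤ Real.log (2 ^ J / ε) := by
      refine Real.log_nonneg ((one_le_div hε0).2 (hε1.le.trans ?_))
      exact one_le_pow₀ one_le_two
    rw [FourierHaar.samplingBound_optimalWeight hne]
    simp_rw [FourierHaar.sum_levelSparsity_add_eq]
    gcongr
    exact FourierHaar.totalWeight_le_sum_decayedSparsity hne
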